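/- **Setting.** Consider the plant $x_{t+1}=A(\theta^*)x_t+B(\theta^*)u_t+Fw_t$, with $A(\theta)=A_0+\sum_{i=1}^p\theta_iA_i$, $B(\theta)=B_0+\sum_{i=1}^p\theta_iB_i$ and unknown $\theta^*\in\mathbb R^p$. Let $K$ be a feedback gain, $A_K(\theta)=A(\theta)+B(\theta)K$, and $N\ge 1$ a horizon. *Noise.* $(w_t)$ is i.i.d. with values in a compact convex set $\mathcal W$, $\mathbb E w_t=0$ and $\mathbb E w_tw_t^\top\succeq\epsilon_wI$, $\epsilon_w>0$. The excitation $(\sigma_t)$ is i.i.d. with values in a compact convex set $\mathcal S$, $\mathbb E\sigma_t=0$ and $\mathbb E\sigma_t\sigma_t^\top\succeq\epsilon_sI$, $\epsilon_s>0$; write $s_{k|t}=\sigma_{t+k}$. *Parameters.* $\Theta_0=\{\theta:\Pi\theta\le\mu_0\}$ is a polytope (bounded) containing $\theta^*$; $(A(\theta),B(\theta))$ is reachable for all $\theta\in\Theta_0$; and $(A(\theta),B(\theta))=(A(\theta^*),B(\theta^*))$ if and only if $\theta=\theta^*$. *Design.* $z^+\in\mathrm{co}\{A_K(\theta)z:\theta\in\Theta_0\}$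 is quadratically stable. $\mathcal X,\mathcal U$ are polytopes, and the terminal set $\mathcal X_T$ satisfies $\mathcal X_T\subseteq\mathcal X$, $K\mathcal X_T\oplus\mathcal S\subseteq\mathcal U$ and $A_K(\theta)\mathcal X_T\oplus B(\theta)\mathcal S\oplus F\mathcal W\subseteq\mathcal X_T$ for all $\theta\in\Theta_0$. A family of sets containing $\mathcal X_T$ (for instance all sets) is allowed as tube cross sections. The stage cost $l$ is a positive definite quadratic form. *MPC problem $\mathcal P(x,\Theta,\hat\theta)$.* Minimise $$\sum_{k<N}l(\hat x_k,K\hat x_k+v_k)+V(\hat x_N),\qquad \hat x_0=x,\quad \hat x_{k+1}=A_K(\hat\theta)\hat x_k+B(\hat\theta)v_k,$$ over $v_0,\dots,v_{N-1}$ and allowed sets $\mathcal X_0,\dots,\mathcal X_N$, subject to $x\in\mathcal X_0$, $\mathcal X_N\subseteq\mathcal X_T$ and, for all $k<N$ and $\theta\in\Theta$, $\mathcal X_k\subseteq\mathcal X$, $K\mathcal X_k\oplus\{v_k\}\subseteq\mathcal U$ and $A_K(\theta)\mathcal X_k\oplus\{B(\theta)v_k\}\oplus F\mathcal W\subseteq\mathcal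 X_{k+1}$. Here $V$ is the positive definite quadratic form with $V(x)=V(A_K(\hat\theta)x)+l(x,Kx)$ for all $x$. *Algorithm.* At time $t$: 1. For $t\ge1$, $\Theta_t$ is the smallest set $\{\theta:\Pi\theta\le\mu_t\}$ containing those $\theta\in\Theta_{t-1}$ with $x_\tau-A(\theta)x_{\tau-1}-B(\theta)u_{\tau-1}\in F\mathcal W$ for all $\max(1,t-N_\mu+1)\le\tau\le t$. Choose any $\hat\theta_t\in\Theta_t$. 2. Let $v^o_t$ be the input sequence of a solution of $\mathcal P(x_t,\Theta_t,\hat\theta_t)$. 3. For $t\ge1$ let $\hat v_t=(v^a_{1|t-1},\dots,v^a_{N-1|t-1},s_{N-1|t})$, where $v^a_{t-1}$ is the sequence adopted at time $t-1$. Draw samples $\zeta^{(i)}\in\Theta_t\times\mathcal W^N$, $i\le N_s$, and let $\delta_t(v)$ be the largest $\delta$ with $\Psi_{\kappa_t|t}(v,\zeta^{(i)})\succeq\delta I$ for all $i$. Put $v^a_t=\hat v_t$ if $t\ge1$ and $\delta_t(v^o_t)<\delta_t(\hat v_t)+\varepsilon$ (the check fails), and $v^a_t=v^o_t$ otherwise.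 4. Apply $u_t=Kx_t+v^a_{0|t}$. Here $\Psi_{\kappa|t}(v,\zeta)=\sum_{k=\kappa}^{\kappa+N_u-1}\Phi_k^\top\Phi_k$, where $\Phi_k$ has the columns $A_ix+B_iu$, $i=1,\dots,p$. They are evaluated at the measured $(x_{t+k},u_{t+k})$ for $k<0$, and for $0\le k<N$ at the state and input predicted with the model, disturbances and inputs given by $\zeta$ and $v$. For $k\ge N$ the expectation over $s_{j|t}$ and $w_{t+j}$, $j\ge N$, is taken, with the predicted state at step $N$ held fixed. Moreover $\kappa_0=N-1$, and $\kappa_{t+1}=\kappa_t-1$ if $\kappa_t>-N_u+1$, $\kappa_{t+1}=N-1$ otherwise. **Proposition.** Under these assumptions: 1. (Recursive feasibility.) If $\mathcal P(x_0,\Theta_0,\hat\theta_0)$ is feasible, then $\mathcal P(x_t,\Theta_t,\hat\theta_t)$ is feasible at every time $t$ that the closed loop reaches. 2. (ISpS.) On the set of $x_0$ for which $\mathcal P(x_0,\Theta_0,\hat\theta_0)$ is feasible, the closed loop is input-to-state practically stable with respect to the input $d_t=Fw_t+B(\theta^*)s_t$, where $s_t=s_{N|t-N}=\sigma_t$ for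 $t\ge N$ and $s_t=0$ for $t<N$: there are a $\mathcal{KL}$-function $\beta$, a $\mathcal K$-function $\gamma$ and $c\ge0$ with $\|x_t\|\le\beta(\|x_0\|,t)+\gamma(\max_{\tau<t}\|d_\tau\|)+c$ for all $t$ and all realisations. 3. (Gains.) There are a $\mathcal{KL}$-function $\eta$ and $\mathcal K$-functions $\psi,\xi$ such that, for all such $x_0$, all $t$ and all realisations, $$\|x_t\|\le\eta(\|x_0\|,t)+\psi\Bigl(\max_{\tau<t}\|Fw_\tau+B(\theta^*)\bar s_\tau\|\Bigr)+\xi\Bigl(\max_{\tau<t}\|\hat\theta_\tau-\theta^*\|\Bigr),$$ where $\bar s_\tau$ is the excitation that acts on the plant at time $\tau$: $\bar s_\tau=s_\tau$ if $\tau\ge N$ and the check failed at each of the times $\tau-N+1,\dots,\tau$ (so that $s_\tau$ is the first element of the adopted sequence), and $\bar s_\tau=0$ otherwise. (Maxima over the empty set are $0$.) -/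

import Mathlib

open MeasureTheory ProbabilityTheory
open scoped NNReal

noncomputable section

namespace AdaptiveMPC

/-- Euclidean space of dimension `n`. -/
abbrev E (n : ℕ) : Type := EuclideanSpace ℝ (Fin n)

/-! ### Comparison functions and input-to-state practical stability -/

/-- Class `K`: continuous, strictly increasing on `[0, ∞)`, zero at zero. -/
structure IsClassK (g : ℝ → ℝ) : Prop where
  continuousOn : ContinuousOn g (Set.Ici 0)
  strictMonoOn : StrictMonoOn g (Set.Ici 0)
  map_zero : g 0 = 0

/-- Class `KL` in discrete time: class `K` in the first argument, and nonincreasing with limit zero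
in the second one. -/
structure IsClassKL (b : ℝ → ℕ → ℝ) : Prop where
  classK : ∀ t, IsClassK fun r => b r t
  antitone : ∀ r, 0 ≤ r → Antitone (b r)
  tendsto : ∀ r, 0 ≤ r → Filter.Tendsto (b r) Filter.atTop (nhds 0)

/-- `max_{τ ∈ {0, …, t-1}} ‖d τ‖`, which is `0` for `t = 0`. -/
def runningMax {V : Type*} [NormedAddCommGroup V] (d : ℕ → V) (t : ℕ) : ℝ :=
  (((Finset.range t).sup fun τ => ‖d τ‖₊ : ℝ≥0) : ℝ)

/-- Input-to-state practical stability on a set `Γ` of initial states.  `Sol T x d` says that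
`x 0, …, x T` is an initial segment of a state trajectory of the system, generated with the
input values `d 0, …, d (T-1)`. -/
def InputToStatePracticallyStable {V V' : Type*} [NormedAddCommGroup V] [NormedAddCommGroup V']
    (Sol : ℕ → (ℕ → V) → (ℕ → V') → Prop) (Γ : Set V) : Prop :=
  ∃ (β : ℝ → ℕ → ℝ) (γ : ℝ → ℝ) (c : ℝ), IsClassKL β ∧ IsClassK γ ∧ 0 ≤ c ∧
    ∀ T x d, Sol T x d → x 0 ∈ Γ → ‖x T‖ ≤ β ‖x 0‖ T + γ (runningMax d T) + c

/-- A polytope: the convex hull of finitely many points. -/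
def IsPolytope {n : ℕ} (C : Set (E n)) : Prop :=
  ∃ s : Finset (E n), convexHull ℝ (s : Set (E n)) = C

/-! ### Data of the controller -/

/-- The quantities known to the controller. -/
structure Design (nx nu nw p nT : ℕ) where
  /-- model: `A(θ) = A₀ + ∑ θᵢ Aᵢ`, `B(θ) = B₀ + ∑ θᵢ Bᵢ` -/
  A₀ : E nx →L[ℝ] E nx
  A : Fin p → E nx →L[ℝ] E nx
  B₀ : E nu →L[ℝ] E nx
  B : Fin p → E nu →L[ℝ] E nx
  F : E nw →L[ℝ] E nx
  /-- disturbance set, excitation set, state and input constraint sets, terminal set -/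
  W : Set (E nw)
  S : Set (E nu)
  X : Set (E nx)
  U : Set (E nu)
  XT : Set (E nx)
  /-- the family of sets that may be used as cross sections of tubes
  (all sets, or a parameterised family such as ellipsoids or polytopes of fixed complexity) -/
  TubeSets : Set (Set (E nx))
  /-- feedback gain -/
  K : E nx →L[ℝ] E nu
  /-- parameter sets are `{θ : Π θ ≤ μ}`, with initial value `μ = μ₀` -/
  Pi : Matrix (Fin nT) (Fin p) ℝ
  μ₀ : Fin nT → ℝ
  /-- stage cost -/
  l : QuadraticForm ℝ (E nx × E nu)
  /-- prediction horizon, length of the excitation window, number of unfalsified sets used in the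
  parameter set update, number of samples, threshold of the excitation check -/
  N : ℕ
  Nu : ℕ
  Nμ : ℕ
  Ns : ℕ
  ε : ℝ

namespace Design

variable {nx nu nw p nT : ℕ} (D : Design nx nu nw p nT)

def Aθ (θ : E p) : E nx →L[ℝ] E nx := D.A₀ + ∑ i, θ i • D.A i

def Bθ (θ : E p) : E nu →L[ℝ] E nx := D.B₀ + ∑ i, θ i • D.B i

/-- `A_K(θ) = A(θ) + B(θ) K` -/
def AK (θ : E p) : E nx →L[ℝ] E nx := D.Aθ θ + (D.Bθ θ).comp D.K

/-- `{θ : Π θ ≤ μ}` -/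
def ParamSet (μ : Fin nT → ℝ) : Set (E p) := {θ | ∀ i, D.Pi.mulVec θ.ofLp i ≤ μ i}

/-- the initial parameter set -/
def Θ₀ : Set (E p) := D.ParamSet D.μ₀

/-- Standing requirements on the design. -/
structure Admissible : Prop where
  horizon_pos : 0 < D.N
  compact_W : IsCompact D.W
  convex_W : Convex ℝ D.W
  compact_S : IsCompact D.S
  convex_S : Convex ℝ D.S
  polytope_X : IsPolytope D.X
  polytope_U : IsPolytope D.U
  /-- `Θ₀` is a polytope, i.e. a bounded polyhedron -/
  bounded_Θ₀ : Bornology.IsBounded D.Θ₀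
  /-- `z⁺ ∈ co {A_K(θ) z : θ ∈ Θ₀}` is quadratically stable -/
  quadratically_stable : ∃ (V : QuadraticForm ℝ (E nx)) (a : ℝ), V.PosDef ∧ 0 < a ∧
    ∀ z, ∀ y ∈ convexHull ℝ {y | ∃ θ ∈ D.Θ₀, y = D.AK θ z}, V y ≤ V z - a * ‖z‖ ^ 2
  /-- the terminal set satisfies the constraints and is robustly invariant -/
  terminal_state : D.XT ⊆ D.X
  terminal_input : ∀ x ∈ D.XT, ∀ σ ∈ D.S, D.K x + σ ∈ D.U
  terminal_invariant : ∀ θ ∈ D.Θ₀, ∀ x ∈ D.XT, ∀ σ ∈ D.S, ∀ w ∈ D.W,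
    D.AK θ x + D.Bθ θ σ + D.F w ∈ D.XT
  /-- the terminal set may be used as a cross section of a tube -/
  terminal_tubeSet : D.XT ∈ D.TubeSets
  posDef_l : D.l.PosDef

/-- The assumption on the model parameters (affine dependence on `θ` being built into the model):
`θs` is the true parameter vector. -/
structure ParamAssumption (θs : E p) : Prop where
  mem : θs ∈ D.Θ₀
  reachable : ∀ θ ∈ D.Θ₀,
    (⨆ k ∈ Finset.range nx, LinearMap.range ((D.Aθ θ ^ k).comp (D.Bθ θ)).toLinearMap) = ⊤
  identifiable : ∀ θ, (D.Aθ θs = D.Aθ θ ∧ D.Bθ θs = D.Bθ θ) ↔ θ = θs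

end Design

/-- An i.i.d. sequence with values in `C`, zero mean and positive definite second moment. -/
structure IsNoise {Ω : Type*} [MeasurableSpace Ω] (P : Measure Ω) {n : ℕ} (C : Set (E n))
    (w : ℕ → Ω → E n) : Prop where
  measurable : ∀ t, Measurable (w t)
  mem : ∀ t ω, w t ω ∈ C
  indep : iIndepFun w P
  identDistrib : ∀ t, IdentDistrib (w t) (w 0) P P
  mean_zero : ∀ t, ∫ ω, w t ω ∂P = 0
  covariance : ∃ e : ℝ, 0 < e ∧ ∀ t (y : E n), e * ‖y‖ ^ 2 ≤ ∫ ω, (inner ℝ y (w t ω)) ^ 2 ∂P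

namespace Design

variable {nx nu nw p nT : ℕ} (D : Design nx nu nw p nT)

/-! ### The MPC optimisation problem -/

/-- Predicted states under `u k = K x k + v k`, for a parameter `θ` and disturbances `w`. -/
def predict (θ : E p) (x : E nx) (v : ℕ → E nu) (w : ℕ → E nw) : ℕ → E nx
  | 0 => x
  | k + 1 => D.Aθ θ (predict θ x v w k) + D.Bθ θ (D.K (predict θ x v w k) + v k) + D.F (w k)

/-- `(v, 𝒳)` satisfies the constraints of the MPC problem at state `x` with parameter set `Θ`.
Only `v 0, …, v (N-1)` and `𝒳 0, …, 𝒳 N` matter. -/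
structure IsFeasiblePair (x : E nx) (Θ : Set (E p)) (v : ℕ → E nu) (𝒳 : ℕ → Set (E nx)) :
    Prop where
  tubeSet : ∀ k ≤ D.N, 𝒳 k ∈ D.TubeSets
  state : ∀ k < D.N, 𝒳 k ⊆ D.X
  input : ∀ k < D.N, ∀ y ∈ 𝒳 k, D.K y + v k ∈ D.U
  step : ∀ k < D.N, ∀ θ ∈ Θ, ∀ y ∈ 𝒳 k, ∀ w ∈ D.W,
    D.AK θ y + D.Bθ θ (v k) + D.F w ∈ 𝒳 (k + 1)
  initial : x ∈ 𝒳 0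
  terminal : 𝒳 D.N ⊆ D.XT

/-- Feasibility of the MPC problem at state `x` with parameter set `Θ` (the nominal parameter
enters the objective only). -/
def Feasible (x : E nx) (Θ : Set (E p)) : Prop := ∃ v 𝒳, D.IsFeasiblePair x Θ v 𝒳

/-- `V` is the terminal cost for the nominal parameter `θ`: a positive definite quadratic form
with `V(x) = V(A_K(θ) x) + l(x, K x)`. -/
def IsTerminalCost (θ : E p) (V : QuadraticForm ℝ (E nx)) : Prop :=
  V.PosDef ∧ ∀ x, V x = V (D.AK θ x) + D.l (x, D.K x)

/-- Nominal predicted cost. -/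
def J (V : QuadraticForm ℝ (E nx)) (x : E nx) (θ : E p) (v : ℕ → E nu) : ℝ :=
  ∑ k ∈ Finset.range D.N, D.l (D.predict θ x v 0 k, D.K (D.predict θ x v 0 k) + v k)
    + V (D.predict θ x v 0 D.N)

/-- `(v, 𝒳)` solves the MPC problem. -/
def IsSolution (V : QuadraticForm ℝ (E nx)) (x : E nx) (Θ : Set (E p)) (θ : E p)
    (v : ℕ → E nu) (𝒳 : ℕ → Set (E nx)) : Prop :=
  D.IsFeasiblePair x Θ v 𝒳 ∧
    ∀ v' 𝒳', D.IsFeasiblePair x Θ v' 𝒳' → D.J V x θ v ≤ D.J V x θ v'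

/-! ### The closed loop -/

/-- The variables of the closed loop, indexed by time `t`. -/
structure Run (D : Design nx nu nw p nT) where
  x : ℕ → E nx
  u : ℕ → E nu
  /-- the parameter set at time `t` is `{θ : Π θ ≤ μ t}` -/
  μ : ℕ → Fin nT → ℝ
  /-- nominal parameter and the corresponding terminal cost -/
  θhat : ℕ → E p
  V : ℕ → QuadraticForm ℝ (E nx)
  /-- solution `(vopt t, tube t)` of the MPC problem -/
  vopt : ℕ → ℕ → E nu
  tube : ℕ → ℕ → Set (E nx)
  /-- input sequence that is adopted after the excitation check -/
  v : ℕ → ℕ → E nu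
  /-- samples `(θ, w 0, …, w (N-1))` drawn for the excitation check -/
  ζ : ℕ → Fin D.Ns → E p × (ℕ → E nw)

/-- Start of the excitation window relative to the current time: initially `N - 1`, then decreased
by one at each step until it equals `-Nu + 1`, when it is reset to `N - 1`. -/
def κ : ℕ → ℤ
  | 0 => D.N - 1
  | t + 1 => if κ t > -D.Nu + 1 then κ t - 1 else D.N - 1

/-- `Φ(x,u)ᵀ Φ(x,u)` where the columns of `Φ(x,u)` are `Aᵢ x + Bᵢ u`. -/
def gram (x : E nx) (u : E nu) : Matrix (Fin p) (Fin p) ℝ :=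
  Matrix.of fun i j => inner ℝ (D.A i x + D.B i u) (D.A j x + D.B j u)

/-- `ΦᵀΦ` at the `k`th predicted state and input. -/
def predGram (θ : E p) (x : E nx) (v : ℕ → E nu) (w : ℕ → E nw) (k : ℕ) :
    Matrix (Fin p) (Fin p) ℝ :=
  D.gram (D.predict θ x v w k) (D.K (D.predict θ x v w k) + v k)

namespace Run

variable {D} (r : Run D)

/-- parameter set at time `t` -/
def Θ (t : ℕ) : Set (E p) := D.ParamSet (r.μ t)

/-- Parameters that are not falsified by the transition from time `τ - 1` to time `τ`. -/
def Δ (τ : ℕ) : Set (E p) :=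
  {θ | r.x τ - (D.Aθ θ (r.x (τ - 1)) + D.Bθ θ (r.u (τ - 1))) ∈ D.F '' D.W}

/-- The set that the parameter set at time `t ≥ 1` has to contain:
`⋂_{τ = t - Nμ + 1}^t Δ τ ∩ Θ (t-1)`, where only the available transitions `τ ≥ 1` are used. -/
def unfalsified (t : ℕ) : Set (E p) :=
  {θ | θ ∈ r.Θ (t - 1) ∧ ∀ τ, 1 ≤ τ → τ ≤ t → t < τ + D.Nμ → θ ∈ r.Δ τ}

/-- Reference input sequence at time `t ≥ 1`: the sequence adopted at time `t - 1`, shifted, with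
the random input `s_{N-1|t}` appended.  `σ j` is the excitation for time `j`, so that
`s_{k|t} = σ (t + k)`. -/
def vref (σ : ℕ → E nu) (t k : ℕ) : E nu :=
  if k + 1 < D.N then r.v (t - 1) (k + 1) else σ (t + (D.N - 1))

variable {Ω : Type*} [MeasurableSpace Ω] (P : Measure Ω) (w : ℕ → Ω → E nw) (s : ℕ → Ω → E nu)

/-- Contribution of prediction step `k` to the excitation matrix at time `t`, for the input sequence
`v` and the sample `z`: measured values for `k < 0`, predicted values for `0 ≤ k < N`, and for
`k ≥ N` the expectation over future excitation and disturbances, the predicted state at step `N`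
being held fixed. -/
def excitationTerm (t : ℕ) (v : ℕ → E nu) (z : E p × (ℕ → E nw)) (k : ℤ) :
    Matrix (Fin p) (Fin p) ℝ :=
  if k < 0 then D.gram (r.x ((t : ℤ) + k).toNat) (r.u ((t : ℤ) + k).toNat)
  else if k < D.N then D.predGram z.1 (r.x t) v z.2 k.toNat
  else Matrix.of fun i j => ∫ ω, D.predGram z.1 (r.x t)
    (fun m => if m < D.N then v m else s (t + m) ω)
    (fun m => if m < D.N then z.2 m else w (t + m) ω) k.toNat i j ∂P

/-- The excitation matrix `Ψ_{κ|t}(v, z)`. -/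
def Ψ (t : ℕ) (v : ℕ → E nu) (z : E p × (ℕ → E nw)) : Matrix (Fin p) (Fin p) ℝ :=
  ∑ k ∈ Finset.Icc (D.κ t) (D.κ t + D.Nu - 1), r.excitationTerm P w s t v z k

/-- The largest `δ` with `Ψ_{κ|t}(v, ζ⁽ⁱ⁾) ⪰ δ I` for all samples. -/
def δ (t : ℕ) (v : ℕ → E nu) : ℝ :=
  sSup {d : ℝ | ∀ i, (r.Ψ P w s t v (r.ζ t i) - d • (1 : Matrix (Fin p) (Fin p) ℝ)).PosSemidef}

/-- The excitation check fails at time `t`, so that the reference input sequence is adopted.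
There is no reference sequence at time `0`. -/
def CheckFails (σ : ℕ → E nu) (t : ℕ) : Prop :=
  0 < t ∧ r.δ P w s t (r.vopt t) < r.δ P w s t (r.vref σ t) + D.ε

open Classical in
/-- `r` is an execution of the algorithm up to time `T` in closed loop with the plant with parameter
`θs`, for the outcome `ω` of disturbance and excitation: measurement and estimation have
been carried out at the times `0, …, T`, optimisation, excitation check and control at the times
`0, …, T - 1`. -/
structure IsExecution (θs : E p) (ω : Ω) (T : ℕ) : Prop where
  μ_zero : r.μ 0 = D.μ₀
  /-- smallest set `{θ : Π θ ≤ μ}` that contains the unfalsified parameters -/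
  μ_succ : ∀ t < T, ∀ i,
    IsLUB ((fun θ : E p => D.Pi.mulVec θ.ofLp i) '' r.unfalsified (t + 1)) (r.μ (t + 1) i)
  nominal : ∀ t ≤ T, r.θhat t ∈ r.Θ t
  terminalCost : ∀ t ≤ T, D.IsTerminalCost (r.θhat t) (r.V t)
  solution : ∀ t < T, D.IsSolution (r.V t) (r.x t) (r.Θ t) (r.θhat t) (r.vopt t) (r.tube t)
  sample : ∀ t < T, ∀ i, (r.ζ t i).1 ∈ r.Θ t ∧ ∀ k < D.N, (r.ζ t i).2 k ∈ D.W
  adopted : ∀ t < T, r.v t =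
    if r.CheckFails P w s (fun j => s j ω) t then r.vref (fun j => s j ω) t else r.vopt t
  control : ∀ t < T, r.u t = D.K (r.x t) + r.v t 0
  plant : ∀ t < T, r.x (t + 1) = D.Aθ θs (r.x t) + D.Bθ θs (r.u t) + D.F (w t ω)

open Classical in
/-- The excitation that acts on the plant at time `t`: it is `s_t` if the reference sequence has
been adopted at each of the last `N` times `t - N + 1, …, t ≥ N` (exactly then is `s_t`
the first element of the adopted sequence by construction), and `0` otherwise. -/
def injected (ω : Ω) (t : ℕ) : E nu :=
  if ∀ τ ≤ t, t < τ + D.N → r.CheckFails P w s (fun j => s j ω) τ then s t ω else 0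

end Run

end Design

end AdaptiveMPC

end

noncomputable section

namespace AdaptiveMPC

/-! ### Quadratic forms on normed spaces -/

section QuadraticForms

variable {V : Type*} [NormedAddCommGroup V] [NormedSpace ℝ V]

/-! The Lyapunov function is the nominal cost of a feasible input sequence, but not of the adopted
one: the excitation check may keep a shifted sequence whose random tail has no decreasing cost.
Replacing the appended random inputs by zero gives `deterministicPart`. It shares a tube with the
adopted sequence, because appended steps start in the terminal set, which is invariant under every
excitation, zero included (`IsFeasiblePair.shift`, `IsExecution.feasiblePair`). Recursive
feasibility follows at once.

If the check fails, the stripped sequence is the shift of its predecessor; if it passes, it is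
optimal and costs no more than that shift. Appending zero makes the nominal cost drop by exactly the
stage cost (`J_shift`). The true successor state and the next nominal parameter differ from the
nominal ones by terms controlled by the acting input and the parameter error, and the cost is
Lipschitz on bounded sets (`exists_J_bound`); hence the perturbed decrease in `exists_J_decrease`.

Turning decrease into contraction needs an upper bound of the cost by a multiple of `‖x‖ ^ 2`. This
is available when the check passes (`exists_solution_J_le`), and after `N` consecutive failures,
when the stripped sequence is zero and its cost is the terminal cost. Every `N` consecutive times
contain one of these events, and at other times the cost merely drifts; `le_of_window_contraction`
gives geometric decay, and `exists_gains` translates it to the state.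

The quadratic upper bound requires a ball around the origin inside the terminal set. Nondegenerate
centred excitation puts a ball into `S` (`IsNoise.exists_ball_subset`), and reachability carries it
into the terminal set (`exists_ball_subset_terminal`).

Practical stability is a corollary of the gain estimate: the acting excitation differs from the
nominal input by a bounded amount, and the parameter error is bounded because `Θ₀` is; both go into
the constant. -/

lemma quadraticForm_continuous [FiniteDimensional ℝ V] (Q : QuadraticForm ℝ V) :
    Continuous Q := by
  have h : ∀ x, Q x = (QuadraticMap.associated Q).toContinuousBilinearMap x x := fun x => by
    rw [LinearMap.toContinuousBilinearMap_apply, QuadraticMap.associated_eq_self_apply]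
  rw [show (Q : V → ℝ) = fun x => (QuadraticMap.associated Q).toContinuousBilinearMap x x from
    funext h]
  fun_prop

lemma quadraticForm_unit_scaling (Q : QuadraticForm ℝ V) (x : V) :
    Q x = ‖x‖ ^ 2 * Q (‖x‖⁻¹ • x) := by
  rcases eq_or_ne x 0 with rfl | hx
  · simp
  · have := norm_ne_zero_iff.mpr hx
    rw [QuadraticMap.map_smul, smul_eq_mul]
    field_simp

lemma exists_quadraticForm_le [FiniteDimensional ℝ V] (Q : QuadraticForm ℝ V) :
    ∃ C, 0 < C ∧ ∀ x, |Q x| ≤ C * ‖x‖ ^ 2 := by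
  obtain ⟨C, hC⟩ := (isCompact_closedBall (0 : V) 1).exists_bound_of_continuousOn
    (quadraticForm_continuous Q).continuousOn
  refine ⟨max C 1, by positivity, fun x => ?_⟩
  have h1 : ‖Q (‖x‖⁻¹ • x)‖ ≤ C := by
    refine hC _ ?_
    rw [mem_closedBall_zero_iff, norm_smul, norm_inv, norm_norm]
    exact inv_mul_le_one
  rw [quadraticForm_unit_scaling Q x, abs_mul, abs_of_nonneg (sq_nonneg ‖x‖), mul_comm]
  exact mul_le_mul_of_nonneg_right (h1.trans (le_max_left _ _)) (sq_nonneg _)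

lemma exists_le_quadraticForm [FiniteDimensional ℝ V] {Q : QuadraticForm ℝ V} (hQ : Q.PosDef) :
    ∃ c, 0 < c ∧ ∀ x, c * ‖x‖ ^ 2 ≤ Q x := by
  rcases subsingleton_or_nontrivial V with h | h
  · exact ⟨1, one_pos, fun x => by simp [Subsingleton.elim x 0]⟩
  obtain ⟨y, hy, hmin⟩ := (isCompact_sphere (0 : V) 1).exists_isMinOn
    (NormedSpace.sphere_nonempty.mpr zero_le_one) (quadraticForm_continuous Q).continuousOn
  have hy0 : y ≠ 0 := fun h0 => by simp [h0] at hy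
  refine ⟨Q y, hQ y hy0, fun x => ?_⟩
  rcases eq_or_ne x 0 with rfl | hx
  · simp
  rw [quadraticForm_unit_scaling Q x, mul_comm]
  refine mul_le_mul_of_nonneg_left (hmin ?_) (sq_nonneg _)
  rw [mem_sphere_zero_iff_norm, norm_smul, norm_inv, norm_norm,
    inv_mul_cancel₀ (norm_ne_zero_iff.mpr hx)]

/-- By bilinearity it suffices to treat unit vectors, where `‖u + v‖ ^ 2 ≤ 4` gives the factor `6 =
4 + 1 + 1`. -/
lemma abs_polar_le {Q : QuadraticForm ℝ V} {C : ℝ} (hQ : ∀ x, |Q x| ≤ C * ‖x‖ ^ 2) (x y : V) :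
    |QuadraticMap.polar Q x y| ≤ 6 * C * (‖x‖ * ‖y‖) := by
  rcases eq_or_ne x 0 with rfl | hx
  · simp
  rcases eq_or_ne y 0 with rfl | hy
  · simp
  have hx' := norm_pos_iff.mpr hx
  have hy' := norm_pos_iff.mpr hy
  have hC : 0 ≤ C := by
    have := (abs_nonneg _).trans (hQ x)
    exact nonneg_of_mul_nonneg_left this (by positivity)
  have key : ∀ u v : V, ‖u‖ = 1 → ‖v‖ = 1 → |QuadraticMap.polar Q u v| ≤ 6 * C := by
    intro u v hu hv
    have h1 := hQ (u + v)
    have h2 := hQ u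
    have h3 := hQ v
    have h4 : ‖u + v‖ ^ 2 ≤ 4 := by
      have := norm_add_le u v
      rw [hu, hv] at this
      nlinarith [norm_nonneg (u + v)]
    have h5 := mul_le_mul_of_nonneg_left h4 hC
    rw [hu] at h2
    rw [hv] at h3
    rw [abs_le] at *
    simp only [QuadraticMap.polar]
    constructor <;> linarith
  have hxe : ‖x‖ • (‖x‖⁻¹ • x) = x := smul_inv_smul₀ hx'.ne' x
  have hye : ‖y‖ • (‖y‖⁻¹ • y) = y := smul_inv_smul₀ hy'.ne' y
  have := key (‖x‖⁻¹ • x) (‖y‖⁻¹ • y) (by rw [norm_smul, norm_inv, norm_norm]; field_simp)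
    (by rw [norm_smul, norm_inv, norm_norm]; field_simp)
  rw [← hxe, ← hye, QuadraticMap.polar_smul_left, QuadraticMap.polar_smul_right, hxe, hye,
    smul_eq_mul, smul_eq_mul, abs_mul, abs_mul, abs_norm, abs_norm]
  calc _ = (‖x‖ * ‖y‖) * |QuadraticMap.polar Q (‖x‖⁻¹ • x) (‖y‖⁻¹ • y)| := by ring
    _ ≤ (‖x‖ * ‖y‖) * (6 * C) := by gcongr
    _ = _ := by ring

lemma abs_quadraticForm_sub_le {Q : QuadraticForm ℝ V} {C : ℝ} (hC : 0 ≤ C)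
    (hQ : ∀ x, |Q x| ≤ C * ‖x‖ ^ 2) (x y : V) :
    |Q x - Q y| ≤ 7 * C * (‖x - y‖ * (‖x‖ + ‖y‖)) := by
  have h1 : Q x - Q y = Q (x - y) + QuadraticMap.polar Q (x - y) y := by
    simp only [QuadraticMap.polar, sub_add_cancel]
    ring
  have h2 := hQ (x - y)
  have h3 := abs_polar_le hQ (x - y) y
  have h4 : C * ‖x - y‖ ^ 2 ≤ C * (‖x - y‖ * (‖x‖ + ‖y‖)) := by
    rw [sq]
    gcongr
    exact norm_sub_le _ _
  have h5 : 6 * C * (‖x - y‖ * ‖y‖) ≤ 6 * C * (‖x - y‖ * (‖x‖ + ‖y‖)) := by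
    gcongr
    linarith [norm_nonneg x]
  rw [h1]
  refine (abs_add_le _ _).trans ?_
  linarith

end QuadraticForms

/-! ### Sequences that contract once in each window -/

lemma drift_of_step_le {a : ℕ → ℝ} {p : ℝ} {T : ℕ} (hstep : ∀ t, t + 1 < T → a (t + 1) ≤ a t + p)
    (t j : ℕ) (h : t + j < T) : a (t + j) ≤ a t + j * p := by
  induction j with
  | zero => simp
  | succ j ih =>
    have h1 := ih (by omega)
    have h2 := hstep (t + j) (by omega)
    rw [← add_assoc]
    push_cast
    linarith

/-- Over a window of length `N` the sequence contracts once and drifts by at most `p` at each other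
step, so sampling at multiples of `N` gives a geometric recursion; the remaining `t % N` steps only
drift. -/
lemma le_of_window_contraction {a : ℕ → ℝ} {p ρ : ℝ} {T N : ℕ} (hN : 0 < N) (hp : 0 ≤ p)
    (hρ0 : 0 ≤ ρ) (hρ1 : ρ < 1)
    (hstep : ∀ t, t + 1 < T → a (t + 1) ≤ a t + p)
    (hwin : ∀ t, ∃ j < N, t + j + 1 < T → a (t + j + 1) ≤ ρ * a (t + j) + p)
    (t : ℕ) (ht : t < T) :
    a t ≤ ρ ^ (t / N) * a 0 + (N / (1 - ρ) + N) * p := by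
  have hwindow : ∀ t, t + N < T → a (t + N) ≤ ρ * a t + N * p := by
    intro t ht
    obtain ⟨j, hj, hc⟩ := hwin t
    have h1 := drift_of_step_le hstep t j (by omega)
    have h2 := hc (by omega)
    have h3 := drift_of_step_le hstep (t + j + 1) (N - (j + 1)) (by omega)
    rw [show t + j + 1 + (N - (j + 1)) = t + N by omega, Nat.cast_sub (by omega)] at h3
    push_cast at h3
    -- The drift accumulated before the contracting step is multiplied by `ρ ≤ 1`, so it still
    -- counts at most `j * p`.
    have h4 : ρ * a (t + j) ≤ ρ * a t + j * p := by
      have h5 : ρ * (j * p) ≤ 1 * (j * p) := by gcongr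
      have h6 := mul_le_mul_of_nonneg_left h1 hρ0
      linarith
    linarith
  have hmul : ∀ q, N * q < T → a (N * q) ≤ ρ ^ q * a 0 + N / (1 - ρ) * p := by
    intro q
    induction q with
    | zero =>
      intro _
      have : 0 ≤ N / (1 - ρ) * p := by
        have : 0 < 1 - ρ := by linarith
        positivity
      simpa using this
    | succ q ih =>
      intro hq
      rw [Nat.mul_succ] at hq ⊢
      have h1 := hwindow (N * q) hq
      have h2 := mul_le_mul_of_nonneg_left (ih (by omega)) hρ0
      have h3 : ρ * (N / (1 - ρ) * p) + N * p = N / (1 - ρ) * p := by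
        have : 1 - ρ ≠ 0 := by linarith
        field_simp
        ring
      rw [pow_succ]
      linarith
  have hd := Nat.div_add_mod t N
  have hle : N * (t / N) ≤ t := Nat.mul_div_le t N
  have h1 := hmul (t / N) (by omega)
  have h2 := drift_of_step_le hstep (N * (t / N)) (t % N) (by omega)
  rw [hd] at h2
  have h3 : ((t % N : ℕ) : ℝ) * p ≤ N * p := by
    gcongr
    exact (Nat.mod_lt _ hN).le
  linarith

/-! ### Noise -/

lemma IsNoise.nonempty {Ω : Type*} [MeasurableSpace Ω] {P : Measure Ω} [IsProbabilityMeasure P]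
    {n : ℕ} {C : Set (E n)} {w : ℕ → Ω → E n} (hw : IsNoise P C w) : C.Nonempty := by
  have : Nonempty Ω := nonempty_of_isProbabilityMeasure P
  exact ⟨_, hw.mem 0 (Classical.arbitrary Ω)⟩

lemma IsNoise.integrable {Ω : Type*} [MeasurableSpace Ω] {P : Measure Ω} [IsProbabilityMeasure P]
    {n : ℕ} {C : Set (E n)} {w : ℕ → Ω → E n} (hw : IsNoise P C w) (hC : IsCompact C) (t : ℕ) :
    Integrable (w t) P := by
  obtain ⟨R, hR⟩ := hC.isBounded.exists_norm_le
  exact Integrable.of_bound (hw.measurable t).aestronglyMeasurable R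
    (ae_of_all _ fun ω => hR _ (hw.mem t ω))

lemma IsNoise.zero_mem {Ω : Type*} [MeasurableSpace Ω] {P : Measure Ω} [IsProbabilityMeasure P]
    {n : ℕ} {C : Set (E n)} {w : ℕ → Ω → E n} (hw : IsNoise P C w) (hC : IsCompact C)
    (hconv : Convex ℝ C) : (0 : E n) ∈ C := by
  rw [← hw.mean_zero 0]
  exact hconv.integral_mem hC.isClosed (ae_of_all _ (hw.mem 0)) (hw.integrable hC 0)

/-- The support of a centred, nondegenerate noise has the origin in its interior. -/
lemma IsNoise.exists_ball_subset {Ω : Type*} [MeasurableSpace Ω] {P : Measure Ω}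
    [IsProbabilityMeasure P] {n : ℕ} {C : Set (E n)} {w : ℕ → Ω → E n} (hw : IsNoise P C w)
    (hC : IsCompact C) (hconv : Convex ℝ C) : ∃ r, 0 < r ∧ Metric.ball (0 : E n) r ⊆ C := by
  obtain ⟨R, hR0, hR⟩ := hC.isBounded.exists_pos_norm_le
  obtain ⟨e, he, hcov⟩ := hw.covariance
  refine ⟨e / R, by positivity, fun b hb => ?_⟩
  by_contra hbC
  obtain ⟨f, u, hfu, hub⟩ := geometric_hahn_banach_closed_point hconv hC.isClosed hbC
  set y : E n := (InnerProductSpace.toDual ℝ (E n)).symm f with hy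
  have hyf : ∀ z, inner ℝ y z = f z := fun z => InnerProductSpace.toDual_symm_apply
  have hzero : (0 : E n) ∈ C := hw.zero_mem hC hconv
  have hfb : 0 < f b := by
    have := hfu 0 hzero
    rw [map_zero] at this
    linarith
  have hint : Integrable (fun ω => (inner ℝ y (w 0 ω) : ℝ)) P :=
    (hw.integrable hC 0).const_inner y
  have hmean : ∫ ω, (inner ℝ y (w 0 ω) : ℝ) ∂P = 0 := by
    rw [integral_inner (hw.integrable hC 0), hw.mean_zero 0, inner_zero_right]
  -- This expands `(f b - X) * (X + R * ‖y‖) ≥ 0` for `X = inner ℝ y (w 0 ω)`. As `X` has mean zero,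
  -- its second moment is at most `f b * (R * ‖y‖)`, too small for a point `b` this close to the
  -- origin.
  have hpoint : ∀ ω, (inner ℝ y (w 0 ω) : ℝ) ^ 2 ≤
      f b * (R * ‖y‖) + (f b - R * ‖y‖) * inner ℝ y (w 0 ω) := by
    intro ω
    have h1 : (inner ℝ y (w 0 ω) : ℝ) ≤ f b := by
      rw [hyf]
      exact ((hfu _ (hw.mem 0 ω)).trans hub).le
    have h2 : -(R * ‖y‖) ≤ inner ℝ y (w 0 ω) := by
      have h3 := abs_le.mp (abs_real_inner_le_norm y (w 0 ω))
      have h4 : ‖y‖ * ‖w 0 ω‖ ≤ ‖y‖ * R := by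
        gcongr
        exact hR _ (hw.mem 0 ω)
      linarith [h3.1]
    nlinarith [mul_nonneg (sub_nonneg.mpr h1) (sub_nonneg.mpr h2)]
  have h1 : e * ‖y‖ ^ 2 ≤ f b * (R * ‖y‖) := by
    refine (hcov 0 y).trans ?_
    calc _ ≤ ∫ ω, (f b * (R * ‖y‖) + (f b - R * ‖y‖) * inner ℝ y (w 0 ω)) ∂P :=
          integral_mono_of_nonneg (ae_of_all _ fun ω => sq_nonneg _)
            ((integrable_const _).add (hint.const_mul _)) (ae_of_all _ hpoint)
      _ = _ := by
          rw [integral_add (integrable_const _) (hint.const_mul _),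
            integral_const_mul (f b - R * ‖y‖), hmean]
          simp
  have hy0 : 0 < ‖y‖ := by
    rw [norm_pos_iff]
    intro h0
    rw [← hyf b, h0, inner_zero_left] at hfb
    exact lt_irrefl _ hfb
  have h2 : f b ≤ ‖y‖ * ‖b‖ := by
    rw [← hyf]
    exact real_inner_le_norm _ _
  have h3 : ‖b‖ * R < e := by
    rw [mem_ball_zero_iff] at hb
    rwa [lt_div_iff₀ hR0] at hb
  have h4 : f b * (R * ‖y‖) ≤ ‖y‖ * ‖b‖ * (R * ‖y‖) := by gcongr
  have h5 : ‖y‖ ^ 2 * (‖b‖ * R) < ‖y‖ ^ 2 * e := by gcongr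
  linarith

lemma IsPolytope.isBounded {n : ℕ} {C : Set (E n)} (hC : IsPolytope C) :
    Bornology.IsBounded C := by
  obtain ⟨s, rfl⟩ := hC
  exact isBounded_convexHull.mpr s.finite_toSet.isBounded

namespace Design

variable {nx nu nw p nT : ℕ} {D : Design nx nu nw p nT}

/-! ### Bounds on the model -/

lemma norm_sum_smul_sub_le {V V' : Type*} [NormedAddCommGroup V] [NormedSpace ℝ V]
    [NormedAddCommGroup V'] [NormedSpace ℝ V'] (M₀ : V →L[ℝ] V') (M : Fin p → V →L[ℝ] V')
    (θ θ' : E p) :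
    ‖(M₀ + ∑ i, θ i • M i) - (M₀ + ∑ i, θ' i • M i)‖ ≤ (∑ i, ‖M i‖) * ‖θ - θ'‖ := by
  have h : (M₀ + ∑ i, θ i • M i) - (M₀ + ∑ i, θ' i • M i) = ∑ i, (θ - θ') i • M i := by
    rw [add_sub_add_left_eq_sub, ← Finset.sum_sub_distrib]
    exact Finset.sum_congr rfl fun i _ => by rw [PiLp.sub_apply, sub_smul]
  rw [h, Finset.sum_mul]
  refine (norm_sum_le _ _).trans (Finset.sum_le_sum fun i _ => ?_)
  rw [norm_smul, mul_comm]
  gcongr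
  exact PiLp.norm_apply_le _ i

/-- Bounds and Lipschitz constants of the closed-loop model on the initial parameter set. -/
lemma exists_model_bound (hD : D.Admissible) : ∃ M, 1 ≤ M ∧
    (∀ θ ∈ D.Θ₀, ‖D.AK θ‖ ≤ M ∧ ‖D.Bθ θ‖ ≤ M) ∧
    (∀ θ θ', ‖D.AK θ - D.AK θ'‖ ≤ M * ‖θ - θ'‖ ∧ ‖D.Bθ θ - D.Bθ θ'‖ ≤ M * ‖θ - θ'‖) ∧
    ∀ θ ∈ D.Θ₀, ∀ θ' ∈ D.Θ₀, ‖θ - θ'‖ ≤ M := by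
  obtain ⟨R, hR0, hR⟩ := hD.bounded_Θ₀.exists_pos_norm_le
  set a := ∑ i, ‖D.A i‖ with ha
  set b := ∑ i, ‖D.B i‖ with hb
  have ha0 : 0 ≤ a := Finset.sum_nonneg fun i _ => norm_nonneg _
  have hb0 : 0 ≤ b := Finset.sum_nonneg fun i _ => norm_nonneg _
  have hB : ∀ θ θ', ‖D.Bθ θ - D.Bθ θ'‖ ≤ b * ‖θ - θ'‖ := norm_sum_smul_sub_le _ _
  have hA : ∀ θ θ', ‖D.AK θ - D.AK θ'‖ ≤ (a + b * ‖D.K‖) * ‖θ - θ'‖ := by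
    intro θ θ'
    have h1 : D.AK θ - D.AK θ' = (D.Aθ θ - D.Aθ θ') + (D.Bθ θ - D.Bθ θ').comp D.K := by
      simp only [AK, ContinuousLinearMap.sub_comp]
      abel
    rw [h1]
    refine (norm_add_le _ _).trans ?_
    have h2 : ‖D.Aθ θ - D.Aθ θ'‖ ≤ a * ‖θ - θ'‖ := norm_sum_smul_sub_le _ _ _ _
    have h3 := (ContinuousLinearMap.opNorm_comp_le (D.Bθ θ - D.Bθ θ') D.K).trans
      (mul_le_mul_of_nonneg_right (hB θ θ') (norm_nonneg D.K))
    linarith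
  have ha' : 0 ≤ a + b * ‖D.K‖ := by positivity
  set a' := a + b * ‖D.K‖
  have haR : 0 ≤ ‖D.AK 0‖ + a' * R := by positivity
  have hbR : 0 ≤ ‖D.Bθ 0‖ + b * R := by positivity
  refine ⟨1 + (‖D.AK 0‖ + a' * R) + (‖D.Bθ 0‖ + b * R) + a' + b + 2 * R, by linarith,
    fun θ hθ => ⟨?_, ?_⟩, fun θ θ' => ⟨?_, ?_⟩, fun θ hθ θ' hθ' => ?_⟩
  · have h1 := hA θ 0
    rw [sub_zero] at h1
    have h2 := norm_sub_norm_le (D.AK θ) (D.AK 0)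
    have h3 : a' * ‖θ‖ ≤ a' * R := mul_le_mul_of_nonneg_left (hR _ hθ) ha'
    linarith
  · have h1 := hB θ 0
    rw [sub_zero] at h1
    have h2 := norm_sub_norm_le (D.Bθ θ) (D.Bθ 0)
    have h3 : b * ‖θ‖ ≤ b * R := mul_le_mul_of_nonneg_left (hR _ hθ) hb0
    linarith
  · exact (hA θ θ').trans (mul_le_mul_of_nonneg_right (by linarith) (norm_nonneg _))
  · exact (hB θ θ').trans (mul_le_mul_of_nonneg_right (by linarith) (norm_nonneg _))
  · linarith [norm_sub_le θ θ', hR _ hθ, hR _ hθ']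

/-! ### Quadratic stability and terminal costs -/

lemma tendsto_AK_pow (hD : D.Admissible) {θ : E p} (hθ : θ ∈ D.Θ₀) (x : E nx) :
    Filter.Tendsto (fun n => (D.AK θ ^ n) x) Filter.atTop (nhds 0) := by
  obtain ⟨Q, a, hQ, ha, hdec⟩ := hD.quadratically_stable
  have hstep : ∀ z, Q (D.AK θ z) ≤ Q z - a * ‖z‖ ^ 2 := fun z =>
    hdec z _ (subset_convexHull ℝ _ ⟨θ, hθ, rfl⟩)
  have hsum : ∀ n, ∑ k ∈ Finset.range n, ‖(D.AK θ ^ k) x‖ ^ 2 ≤ Q x / a := by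
    -- Telescoping the decrease of the certifying form makes the squared norms of the orbit
    -- summable.
    intro n
    have h : ∀ n, a * ∑ k ∈ Finset.range n, ‖(D.AK θ ^ k) x‖ ^ 2 ≤ Q x - Q ((D.AK θ ^ n) x) := by
      intro n
      induction n with
      | zero => simp
      | succ n ih =>
        have := hstep ((D.AK θ ^ n) x)
        rw [Finset.sum_range_succ, mul_add, pow_succ' (D.AK θ), mul_apply_eq_comp]
        linarith
    rw [le_div_iff₀ ha, mul_comm]
    linarith [h n, hQ.nonneg ((D.AK θ ^ n) x)]
  have h1 := (summable_of_sum_range_le (fun k => sq_nonneg ‖(D.AK θ ^ k) x‖)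
    hsum).tendsto_atTop_zero
  rw [tendsto_zero_iff_norm_tendsto_zero]
  have h2 := h1.sqrt
  simpa [Real.sqrt_sq] using h2

/-- Comparison with the quadratic form that certifies quadratic stability. -/
lemma exists_lyapunov_comparison (hD : D.Admissible) : ∃ L, 0 < L ∧
    ∀ θ ∈ D.Θ₀, ∀ (Q : QuadraticForm ℝ (E nx)) (m : ℝ), 0 ≤ m →
      (∀ x, Q x - Q (D.AK θ x) ≤ m * ‖x‖ ^ 2) → ∀ x, Q x ≤ L * m * ‖x‖ ^ 2 := by
  obtain ⟨G, a, hG, ha, hdec⟩ := hD.quadratically_stable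
  obtain ⟨C, hC, hGC⟩ := exists_quadraticForm_le G
  refine ⟨C / a, by positivity, fun θ hθ Q m hm hQ x => ?_⟩
  -- `Q - (m / a) * G` does not decrease along orbits of `A_K(θ)`, and these tend to zero; hence it
  -- is nonpositive everywhere. No definiteness of `Q` is used, so the argument also covers
  -- differences of terminal costs.
  have hstep : ∀ z, Q z - m / a * G z ≤ Q (D.AK θ z) - m / a * G (D.AK θ z) := by
    intro z
    have h1 := hdec z _ (subset_convexHull ℝ _ ⟨θ, hθ, rfl⟩)
    have h2 := mul_le_mul_of_nonneg_left h1 (div_nonneg hm ha.le)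
    have h3 : m / a * (a * ‖z‖ ^ 2) = m * ‖z‖ ^ 2 := by field_simp
    have h4 := hQ z
    rw [mul_sub, h3] at h2
    linarith
  have hiter : ∀ n, Q x - m / a * G x ≤
      Q ((D.AK θ ^ n) x) - m / a * G ((D.AK θ ^ n) x) := by
    intro n
    induction n with
    | zero => simp
    | succ n ih =>
      rw [pow_succ', mul_apply_eq_comp]
      exact ih.trans (hstep _)
  have hlim : Filter.Tendsto
      (fun n => Q ((D.AK θ ^ n) x) - m / a * G ((D.AK θ ^ n) x)) Filter.atTop (nhds 0) := by
    have hcont : Continuous fun z => Q z - m / a * G z :=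
      (quadraticForm_continuous Q).sub ((quadraticForm_continuous G).const_mul _)
    have := (hcont.tendsto 0).comp (tendsto_AK_pow hD hθ x)
    simpa [Function.comp_def] using this
  have h1 := ge_of_tendsto' hlim hiter
  have h2 : m / a * G x ≤ m / a * (C * ‖x‖ ^ 2) := by
    gcongr
    exact (le_abs_self _).trans (hGC x)
  have h3 : m / a * (C * ‖x‖ ^ 2) = C / a * m * ‖x‖ ^ 2 := by ring
  linarith

/-- Terminal costs are bounded uniformly on the initial parameter set, and depend on the
parameter in a Lipschitz continuous way. -/
lemma exists_terminalCost_bound (hD : D.Admissible) : ∃ C, 1 ≤ C ∧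
    (∀ θ ∈ D.Θ₀, ∀ V, D.IsTerminalCost θ V → ∀ x, |V x| ≤ C * ‖x‖ ^ 2) ∧
    ∀ θ ∈ D.Θ₀, ∀ θ' ∈ D.Θ₀, ∀ V V', D.IsTerminalCost θ V → D.IsTerminalCost θ' V' →
      ∀ x, |V x - V' x| ≤ C * ‖θ - θ'‖ * ‖x‖ ^ 2 := by
  obtain ⟨L, hL, hcomp⟩ := exists_lyapunov_comparison hD
  obtain ⟨Cl, hCl, hl⟩ := exists_quadraticForm_le D.l
  obtain ⟨M, hM, hMb, hMl, -⟩ := exists_model_bound hD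
  set k := 1 + ‖D.K‖ with hk
  have hk0 : 0 < k := by positivity
  set C₁ := L * (Cl * k ^ 2) with hC₁
  have hC₁0 : 0 < C₁ := by positivity
  have hbound : ∀ θ ∈ D.Θ₀, ∀ V, D.IsTerminalCost θ V → ∀ x, |V x| ≤ C₁ * ‖x‖ ^ 2 := by
    intro θ hθ V hV x
    rw [abs_of_nonneg (hV.1.nonneg x)]
    refine hcomp θ hθ V (Cl * k ^ 2) (by positivity) (fun z => ?_) x
    have h1 : ‖(z, D.K z)‖ ≤ k * ‖z‖ := by
      have := D.K.le_opNorm z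
      have := norm_nonneg z
      have := mul_nonneg (norm_nonneg D.K) this
      rw [Prod.norm_mk]
      apply max_le <;> linarith
    calc V z - V (D.AK θ z) = D.l (z, D.K z) := by rw [hV.2 z]; ring
      _ ≤ Cl * ‖(z, D.K z)‖ ^ 2 := (le_abs_self _).trans (hl _)
      _ ≤ Cl * (k * ‖z‖) ^ 2 := by gcongr
      _ = _ := by ring
  have hdiff : ∀ θ ∈ D.Θ₀, ∀ θ' ∈ D.Θ₀, ∀ V V', D.IsTerminalCost θ V → D.IsTerminalCost θ' V' →
      ∀ x, V x - V' x ≤ L * (14 * C₁ * M ^ 2) * ‖θ - θ'‖ * ‖x‖ ^ 2 := by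
    intro θ hθ θ' hθ' V V' hV hV' x
    have := hcomp θ hθ (V - V') (14 * C₁ * M ^ 2 * ‖θ - θ'‖) (by positivity) (fun z => ?_) x
    · rw [sub_apply] at this
      linarith
    have h1 := abs_quadraticForm_sub_le hC₁0.le (hbound θ' hθ' V' hV') (D.AK θ z) (D.AK θ' z)
    have h2 : ‖D.AK θ z - D.AK θ' z‖ ≤ M * ‖θ - θ'‖ * ‖z‖ := by
      rw [← sub_apply]
      exact ContinuousLinearMap.le_of_opNorm_le _ (hMl θ θ').1 z
    have h3 : ‖D.AK θ z‖ + ‖D.AK θ' z‖ ≤ M * ‖z‖ + M * ‖z‖ :=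
      add_le_add (ContinuousLinearMap.le_of_opNorm_le _ (hMb θ hθ).1 z)
        (ContinuousLinearMap.le_of_opNorm_le _ (hMb θ' hθ').1 z)
    -- The stage costs cancel between the two terminal cost equations; what remains is one form
    -- evaluated at two nearby successors.
    calc (V - V') z - (V - V') (D.AK θ z) = V' (D.AK θ z) - V' (D.AK θ' z) := by
          rw [sub_apply, sub_apply, hV.2 z, hV'.2 z]
          ring
      _ ≤ _ := (le_abs_self _).trans h1
      _ ≤ 7 * C₁ * ((M * ‖θ - θ'‖ * ‖z‖) * (M * ‖z‖ + M * ‖z‖)) := by gcongr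
      _ = _ := by ring
  refine ⟨1 + C₁ + L * (14 * C₁ * M ^ 2), ?_, ?_, ?_⟩
  · have : 0 ≤ L * (14 * C₁ * M ^ 2) := by positivity
    linarith
  · intro θ hθ V hV x
    refine (hbound θ hθ V hV x).trans ?_
    gcongr
    have : 0 ≤ L * (14 * C₁ * M ^ 2) := by positivity
    linarith
  · intro θ hθ θ' hθ' V V' hV hV' x
    have h1 := hdiff θ hθ θ' hθ' V V' hV hV' x
    have h2 := hdiff θ' hθ' θ hθ V' V hV' hV x
    rw [norm_sub_rev] at h2
    have h3 : L * (14 * C₁ * M ^ 2) * ‖θ - θ'‖ * ‖x‖ ^ 2 ≤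
        (1 + C₁ + L * (14 * C₁ * M ^ 2)) * ‖θ - θ'‖ * ‖x‖ ^ 2 := by
      gcongr
      linarith
    rw [abs_le]
    constructor <;> linarith

/-! ### The terminal set is a neighbourhood of the origin -/

/-- The indexing runs backwards in time: `σ n` is applied first and `σ 0` last, which turns the
input response into a sum over powers of `A_K(θ)`. -/
lemma terminal_reach (hD : D.Admissible) {θ : E p} (hθ : θ ∈ D.Θ₀) (hW : (0 : E nw) ∈ D.W)
    (n : ℕ) : ∀ σ : ℕ → E nu, (∀ j < n, σ j ∈ D.S) → ∀ x ∈ D.XT,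
      (D.AK θ ^ n) x + ∑ j ∈ Finset.range n, (D.AK θ ^ j) (D.Bθ θ (σ j)) ∈ D.XT := by
  induction n with
  | zero => intro σ _ x hx; simpa using hx
  | succ n ih =>
    intro σ hσ x hx
    have h1 : D.AK θ x + D.Bθ θ (σ n) ∈ D.XT := by
      simpa using hD.terminal_invariant θ hθ x hx (σ n) (hσ n (by omega)) 0 hW
    have h2 := ih σ (fun j hj => hσ j (by omega)) _ h1
    rw [map_add] at h2
    rw [Finset.sum_range_succ, pow_succ, mul_apply_eq_comp]
    convert h2 using 1
    abel

/-- State feedback preserves reachability. -/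
lemma reachable_feedback {θ : E p}
    (h : (⨆ k ∈ Finset.range nx, LinearMap.range ((D.Aθ θ ^ k).comp (D.Bθ θ)).toLinearMap) = ⊤) :
    (⨆ k ∈ Finset.range nx, LinearMap.range ((D.AK θ ^ k).comp (D.Bθ θ)).toLinearMap) = ⊤ := by
  set M : ℕ → Submodule ℝ (E nx) := fun n =>
    ⨆ k ∈ Finset.range n, LinearMap.range ((D.AK θ ^ k).comp (D.Bθ θ)).toLinearMap with hM
  have hmem : ∀ n, ∀ k < n, ∀ u, (D.AK θ ^ k) (D.Bθ θ u) ∈ M n := by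
    intro n k hk u
    have h1 : LinearMap.range ((D.AK θ ^ k).comp (D.Bθ θ)).toLinearMap ≤ M n :=
      le_iSup₂_of_le k (Finset.mem_range.mpr hk) le_rfl
    exact h1 ⟨u, rfl⟩
  have hmono : Monotone M := fun m n hmn =>
    iSup₂_le fun k hk => le_iSup₂_of_le k
      (Finset.mem_range.mpr ((Finset.mem_range.mp hk).trans_le hmn)) le_rfl
  have hA : ∀ n, M n ≤ (M (n + 1)).comap (D.Aθ θ).toLinearMap := by
    intro n
    refine iSup₂_le fun k hk => ?_
    rintro _ ⟨u, rfl⟩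
    -- Since `A = A_K - B K`, applying `A` costs one more power of `A_K` and a correction in the
    -- range of `B`.
    have h1 : D.Aθ θ ((D.AK θ ^ k) (D.Bθ θ u)) =
        (D.AK θ ^ (k + 1)) (D.Bθ θ u) -
          (D.AK θ ^ 0) (D.Bθ θ (D.K ((D.AK θ ^ k) (D.Bθ θ u)))) := by
      rw [pow_succ']
      simp [AK]
    change D.Aθ θ ((D.AK θ ^ k) (D.Bθ θ u)) ∈ M (n + 1)
    rw [h1]
    rw [Finset.mem_range] at hk
    exact (M (n + 1)).sub_mem (hmem _ _ (by omega) _) (hmem _ _ (by omega) _)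
  have hpow : ∀ k u, (D.Aθ θ ^ k) (D.Bθ θ u) ∈ M (k + 1) := by
    intro k u
    induction k with
    | zero => exact hmem 1 0 one_pos u
    | succ k ih =>
      rw [pow_succ', mul_apply_eq_comp]
      exact hA _ ih
  rw [eq_top_iff, ← h]
  refine iSup₂_le fun k hk => ?_
  rintro _ ⟨u, rfl⟩
  rw [Finset.mem_range] at hk
  exact hmono (by omega : k + 1 ≤ nx) (hpow k u)

/-- The terminal set is assumed neither convex nor to contain the origin. Zero inputs bring any of
its points close to the origin without leaving the set; then `nx` steps with small excitations reach
a full neighbourhood, because the surjective input response is open. -/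
lemma exists_ball_subset_terminal (hD : D.Admissible) {θ : E p} (hθ : θ ∈ D.Θ₀)
    (hreach : (⨆ k ∈ Finset.range nx,
      LinearMap.range ((D.Aθ θ ^ k).comp (D.Bθ θ)).toLinearMap) = ⊤)
    (hW : (0 : E nw) ∈ D.W) {ρ : ℝ} (hρ : 0 < ρ) (hS : Metric.ball (0 : E nu) ρ ⊆ D.S)
    (hne : D.XT.Nonempty) : ∃ r, 0 < r ∧ Metric.ball (0 : E nx) r ⊆ D.XT := by
  obtain ⟨z, hz⟩ := hne
  set Λ : (Fin nx → E nu) →ₗ[ℝ] E nx :=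
    ∑ j : Fin nx, ((D.AK θ ^ (j : ℕ)).comp (D.Bθ θ)).toLinearMap ∘ₗ LinearMap.proj j with hΛ
  have hΛa : ∀ σ, Λ σ = ∑ j : Fin nx, (D.AK θ ^ (j : ℕ)) (D.Bθ θ (σ j)) := fun σ => by
    simp only [hΛ, LinearMap.sum_apply]
    rfl
  have hsurj : Function.Surjective Λ := by
    rw [← LinearMap.range_eq_top, eq_top_iff, ← reachable_feedback hreach]
    refine iSup₂_le fun k hk => ?_
    rintro _ ⟨u, rfl⟩
    rw [Finset.mem_range] at hk
    refine ⟨Pi.single ⟨k, hk⟩ u, ?_⟩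
    rw [hΛa, Finset.sum_eq_single ⟨k, hk⟩]
    · simp only [Pi.single_eq_same]
      rfl
    · intro j _ hj
      simp [Pi.single_eq_of_ne hj]
    · simp
  have hopen := LinearMap.isOpenMap_of_finiteDimensional Λ hsurj
  have hnhds : Λ '' Metric.ball 0 ρ ∈ nhds (0 : E nx) := by
    have := hopen.image_mem_nhds (Metric.ball_mem_nhds (0 : Fin nx → E nu) hρ)
    rwa [map_zero] at this
  obtain ⟨r, hr, hball⟩ := Metric.mem_nhds_iff.mp hnhds
  have hlim : Filter.Tendsto (fun n => (D.AK θ ^ nx) ((D.AK θ ^ n) z)) Filter.atTop (nhds 0) := by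
    have := ((D.AK θ ^ nx).continuous.tendsto 0).comp (tendsto_AK_pow hD hθ z)
    rwa [map_zero] at this
  -- The free response is brought within `r / 2`, so the ball of radius `r` around it covers the
  -- ball of radius `r / 2` around the origin.
  obtain ⟨n, hn⟩ := (Metric.tendsto_nhds.mp hlim (r / 2) (half_pos hr)).exists
  rw [dist_zero_right] at hn
  have hzero : (0 : E nu) ∈ D.S := hS (Metric.mem_ball_self hρ)
  have hzn : (D.AK θ ^ n) z ∈ D.XT := by
    simpa using terminal_reach hD hθ hW n 0 (fun j _ => hzero) z hz
  refine ⟨r / 2, half_pos hr, fun y hy => ?_⟩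
  rw [mem_ball_zero_iff] at hy
  have hy' : y - (D.AK θ ^ nx) ((D.AK θ ^ n) z) ∈ Metric.ball (0 : E nx) r := by
    rw [mem_ball_zero_iff]
    linarith [norm_sub_le y ((D.AK θ ^ nx) ((D.AK θ ^ n) z))]
  obtain ⟨σ, hσ, hσy⟩ := hball hy'
  have hσS : ∀ j, σ j ∈ D.S := fun j => hS <| by
    rw [mem_ball_zero_iff] at hσ ⊢
    exact (norm_le_pi_norm σ j).trans_lt hσ
  have := terminal_reach hD hθ hW nx (fun j => if h : j < nx then σ ⟨j, h⟩ else 0)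
    (fun j hj => by simpa [hj] using hσS _) _ hzn
  rw [Finset.sum_range] at this
  simp only [Fin.is_lt, dif_pos, Fin.eta] at this
  rw [← hΛa, hσy, add_sub_cancel] at this
  exact this

/-! ### Nominal predictions and cost -/

lemma predict_succ (θ : E p) (x : E nx) (v : ℕ → E nu) (w : ℕ → E nw) (k : ℕ) :
    D.predict θ x v w (k + 1) =
      D.AK θ (D.predict θ x v w k) + D.Bθ θ (v k) + D.F (w k) := by
  simp only [predict, AK, map_add, add_apply, ContinuousLinearMap.comp_apply, add_assoc]

lemma nominal_succ (θ : E p) (x : E nx) (v : ℕ → E nu) (k : ℕ) :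
    D.predict θ x v 0 (k + 1) = D.AK θ (D.predict θ x v 0 k) + D.Bθ θ (v k) := by
  rw [predict_succ, Pi.zero_apply, map_zero, add_zero]

lemma nominal_shift (θ : E p) (x : E nx) (v v' : ℕ → E nu) (k : ℕ)
    (h : ∀ j < k, v' j = v (j + 1)) :
    D.predict θ (D.AK θ x + D.Bθ θ (v 0)) v' 0 k = D.predict θ x v 0 (k + 1) := by
  induction k with
  | zero => rw [nominal_succ]; rfl
  | succ k ih =>
    rw [nominal_succ, ih fun j hj => h j (by omega), h k (by omega), nominal_succ (k := k + 1)]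

/-- The input sequence `v`, shifted by one step, with the final element `σ`. -/
def shiftAppend (D : Design nx nu nw p nT) (v : ℕ → E nu) (σ : E nu) (k : ℕ) : E nu :=
  if k + 1 < D.N then v (k + 1) else σ

/-- The shifted prediction reuses all stages but the first, and with zero appended the new last
stage and terminal cost add up to the old terminal cost. The equality is exact and needs no
optimality. -/
lemma J_shift (hN : 0 < D.N) {θ : E p} {V : QuadraticForm ℝ (E nx)} (hV : D.IsTerminalCost θ V)
    (x : E nx) (v : ℕ → E nu) :
    D.J V (D.AK θ x + D.Bθ θ (v 0)) θ (D.shiftAppend v 0) =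
      D.J V x θ v - D.l (x, D.K x + v 0) := by
  obtain ⟨n, hn⟩ : ∃ n, D.N = n + 1 := ⟨D.N - 1, by omega⟩
  have hv : ∀ k < n, D.shiftAppend v 0 k = v (k + 1) := fun k hk => if_pos (by omega)
  have hvn : D.shiftAppend v 0 n = 0 := if_neg (by omega)
  have hp : ∀ k ≤ n, D.predict θ (D.AK θ x + D.Bθ θ (v 0)) (D.shiftAppend v 0) 0 k =
      D.predict θ x v 0 (k + 1) := fun k hk =>
    nominal_shift θ x v _ k fun j hj => hv j (by omega)
  have hlast := hV.2 (D.predict θ x v 0 (n + 1))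
  have hsum : ∑ k ∈ Finset.range n,
      D.l (D.predict θ (D.AK θ x + D.Bθ θ (v 0)) (D.shiftAppend v 0) 0 k,
        D.K (D.predict θ (D.AK θ x + D.Bθ θ (v 0)) (D.shiftAppend v 0) 0 k)
          + D.shiftAppend v 0 k) =
      ∑ k ∈ Finset.range n,
        D.l (D.predict θ x v 0 (k + 1), D.K (D.predict θ x v 0 (k + 1)) + v (k + 1)) :=
    Finset.sum_congr rfl fun k hk => by
      rw [Finset.mem_range] at hk
      rw [hp k hk.le, hv k hk]
  unfold J
  rw [hn, Finset.sum_range_succ, hsum, nominal_succ (k := n), hp n le_rfl, hvn, map_zero,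
    add_zero, add_zero, Finset.sum_range_succ']
  have h0 : D.predict θ x v 0 0 = x := rfl
  rw [h0]
  linarith

/-- The terminal cost equation telescopes along the prediction under the pure feedback law. -/
lemma J_zero {θ : E p} {V : QuadraticForm ℝ (E nx)} (hV : D.IsTerminalCost θ V) (x : E nx)
    (v : ℕ → E nu) (hv : ∀ k < D.N, v k = 0) : D.J V x θ v = V x := by
  have h : ∀ n ≤ D.N, ∑ k ∈ Finset.range n,
      D.l (D.predict θ x v 0 k, D.K (D.predict θ x v 0 k) + v k) + V (D.predict θ x v 0 n)
        = V x := by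
    intro n
    induction n with
    | zero => intro _; simp [predict]
    | succ n ih =>
      intro hn
      have h1 := ih (by omega)
      have h2 := hV.2 (D.predict θ x v 0 n)
      rw [Finset.sum_range_succ, nominal_succ, hv n (by omega), map_zero, add_zero, add_zero]
      linarith
  exact h D.N le_rfl

lemma l_le_J (hD : D.Admissible) {θ : E p} {V : QuadraticForm ℝ (E nx)}
    (hV : D.IsTerminalCost θ V) (x : E nx) (v : ℕ → E nu) :
    D.l (x, D.K x + v 0) ≤ D.J V x θ v := by
  have h1 := Finset.single_le_sum (s := Finset.range D.N)
    (f := fun k => D.l (D.predict θ x v 0 k, D.K (D.predict θ x v 0 k) + v k))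
    (fun k _ => hD.posDef_l.nonneg _) (Finset.mem_range.mpr hD.horizon_pos)
  have h2 := hV.1.nonneg (D.predict θ x v 0 D.N)
  exact h1.trans (le_add_of_nonneg_right h2)

lemma exists_nominal_bound (hD : D.Admissible) {R : ℝ} (hR : 0 ≤ R) (n : ℕ) : ∃ C, 1 ≤ C ∧
    ∀ θ ∈ D.Θ₀, ∀ θ' ∈ D.Θ₀, ∀ x x' : E nx, ‖x‖ ≤ R → ‖x'‖ ≤ R → ∀ v : ℕ → E nu,
      (∀ j < n, ‖v j‖ ≤ R) → ∀ k ≤ n, ‖D.predict θ x v 0 k‖ ≤ C ∧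
        ‖D.predict θ x v 0 k - D.predict θ' x' v 0 k‖ ≤ C * (‖θ - θ'‖ + ‖x - x'‖) := by
  obtain ⟨M, hM, hMb, hMl, -⟩ := exists_model_bound hD
  induction n with
  | zero =>
    refine ⟨1 + R, by linarith, fun θ _ θ' _ x x' hx _ v _ k hk => ?_⟩
    obtain rfl : k = 0 := by omega
    refine ⟨by simp only [predict]; linarith, ?_⟩
    simp only [predict]
    have := norm_nonneg (θ - θ')
    have := norm_nonneg (x - x')
    nlinarith
  | succ n ih =>
    obtain ⟨C, hC, h⟩ := ih
    have hMC : 0 ≤ M * C := by positivity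
    have hMR : 0 ≤ M * R := by positivity
    refine ⟨C + 2 * (M * C) + M * R, by linarith,
      fun θ hθ θ' hθ' x x' hx hx' v hv k hk => ?_⟩
    have hn := h θ hθ θ' hθ' x x' hx hx' v fun j hj => hv j (by omega)
    have hδ : 0 ≤ ‖θ - θ'‖ + ‖x - x'‖ := by positivity
    rcases Nat.lt_or_ge n k with hnk | hkn
    · obtain rfl : k = n + 1 := by omega
      obtain ⟨h1, h2⟩ := hn n le_rfl
      have hvn := hv n (by omega)
      simp only [nominal_succ]
      set y := D.predict θ x v 0 n
      set y' := D.predict θ' x' v 0 n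
      have e1 : ‖D.AK θ y‖ ≤ M * C :=
        (ContinuousLinearMap.le_of_opNorm_le _ (hMb θ hθ).1 y).trans (by gcongr)
      have e2 : ‖D.Bθ θ (v n)‖ ≤ M * R :=
        (ContinuousLinearMap.le_of_opNorm_le _ (hMb θ hθ).2 _).trans (by gcongr)
      have e3 : ‖(D.AK θ - D.AK θ') y‖ ≤ M * ‖θ - θ'‖ * C :=
        (ContinuousLinearMap.le_of_opNorm_le _ (hMl θ θ').1 y).trans (by gcongr)
      have e4 : ‖D.AK θ' (y - y')‖ ≤ M * (C * (‖θ - θ'‖ + ‖x - x'‖)) :=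
        (ContinuousLinearMap.le_of_opNorm_le _ (hMb θ' hθ').1 _).trans (by gcongr)
      have e5 : ‖(D.Bθ θ - D.Bθ θ') (v n)‖ ≤ M * ‖θ - θ'‖ * R :=
        (ContinuousLinearMap.le_of_opNorm_le _ (hMl θ θ').2 _).trans (by gcongr)
      refine ⟨(norm_add_le _ _).trans (by linarith), ?_⟩
      -- The model mismatch is evaluated on the first trajectory, and the second model propagates
      -- the state difference.
      have e6 : D.AK θ y + D.Bθ θ (v n) - (D.AK θ' y' + D.Bθ θ' (v n)) =
          (D.AK θ - D.AK θ') y + D.AK θ' (y - y') + (D.Bθ θ - D.Bθ θ') (v n) := by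
        simp only [sub_apply, map_sub]
        abel
      rw [e6]
      refine norm_add₃_le.trans ?_
      have f1 : M * C * ‖θ - θ'‖ ≤ M * C * (‖θ - θ'‖ + ‖x - x'‖) := by
        gcongr
        exact le_add_of_nonneg_right (norm_nonneg _)
      have f2 : M * R * ‖θ - θ'‖ ≤ M * R * (‖θ - θ'‖ + ‖x - x'‖) := by
        gcongr
        exact le_add_of_nonneg_right (norm_nonneg _)
      have f3 : 0 ≤ C * (‖θ - θ'‖ + ‖x - x'‖) := by positivity
      linarith
    · obtain ⟨h1, h2⟩ := hn k hkn
      refine ⟨by linarith, h2.trans ?_⟩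
      gcongr
      linarith

/-- On bounded sets the cost is bounded, and Lipschitz continuous in the initial state and in
the nominal parameter. -/
lemma exists_J_bound (hD : D.Admissible) {R : ℝ} (hR : 0 ≤ R) : ∃ C, 0 < C ∧
    ∀ θ ∈ D.Θ₀, ∀ θ' ∈ D.Θ₀, ∀ V V', D.IsTerminalCost θ V → D.IsTerminalCost θ' V' →
      ∀ x x' : E nx, ‖x‖ ≤ R → ‖x'‖ ≤ R → ∀ v : ℕ → E nu, (∀ j < D.N, ‖v j‖ ≤ R) →
        D.J V x θ v ≤ C ∧ D.J V x θ v - D.J V' x' θ' v ≤ C * (‖θ - θ'‖ + ‖x - x'‖) := by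
  obtain ⟨P, hP, hpred⟩ := exists_nominal_bound hD hR D.N
  obtain ⟨CV, hCV, hVb, hVl⟩ := exists_terminalCost_bound hD
  obtain ⟨Cl, hCl, hl⟩ := exists_quadraticForm_le D.l
  set k₀ := 1 + ‖D.K‖ with hk₀
  have hk₀0 : 0 < k₀ := by positivity
  have hK : ∀ y : E nx, ‖y‖ ≤ k₀ * ‖y‖ ∧ ‖D.K y‖ ≤ k₀ * ‖y‖ := fun y => by
    have h1 := D.K.le_opNorm y
    have h2 := norm_nonneg y
    have h3 := mul_nonneg (norm_nonneg D.K) h2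
    constructor <;> linarith
  set Y := k₀ * P + R with hY
  have hY0 : 0 < Y := by positivity
  -- The constant is the sum of a bound on the cost and a Lipschitz constant, so that it serves both
  -- claims.
  refine ⟨D.N * (Cl * Y ^ 2) + CV * P ^ 2 + D.N * (7 * Cl * (k₀ * P * (Y + Y))) +
    (CV * P ^ 2 + 7 * CV * (P * (P + P))), by positivity,
    fun θ hθ θ' hθ' V V' hV hV' x x' hx hx' v hv => ?_⟩
  have hp := hpred θ hθ θ' hθ' x x' hx hx' v hv
  have hp' := hpred θ' hθ' θ hθ x' x hx' hx v hv
  set δ := ‖θ - θ'‖ + ‖x - x'‖ with hδ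
  have hδ0 : 0 ≤ δ := by positivity
  have hynorm : ∀ y : E nx, ∀ j < D.N, ‖y‖ ≤ P → ‖(y, D.K y + v j)‖ ≤ Y := by
    intro y j hj hy
    have h1 := (hK y).1
    have h2 := (hK y).2
    have h3 := hv j hj
    have h4 : k₀ * ‖y‖ ≤ k₀ * P := by gcongr
    have h5 := norm_add_le (D.K y) (v j)
    rw [Prod.norm_mk]
    apply max_le <;> linarith
  have hN0 : (0 : ℝ) ≤ D.N := by positivity
  constructor
  · have h1 : ∑ k ∈ Finset.range D.N,
        D.l (D.predict θ x v 0 k, D.K (D.predict θ x v 0 k) + v k) ≤ D.N * (Cl * Y ^ 2) := by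
      have := Finset.sum_le_card_nsmul (Finset.range D.N)
        (fun k => D.l (D.predict θ x v 0 k, D.K (D.predict θ x v 0 k) + v k)) (Cl * Y ^ 2)
        (fun k hk => by
          rw [Finset.mem_range] at hk
          refine (le_abs_self _).trans ((hl _).trans ?_)
          gcongr
          exact hynorm _ k hk (hp k hk.le).1)
      simpa using this
    have h2 : V (D.predict θ x v 0 D.N) ≤ CV * P ^ 2 := by
      refine (le_abs_self _).trans ((hVb θ hθ V hV _).trans ?_)
      gcongr
      exact (hp _ le_rfl).1
    have h3 : 0 ≤ D.N * (7 * Cl * (k₀ * P * (Y + Y))) +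
      (CV * P ^ 2 + 7 * CV * (P * (P + P))) := by positivity
    unfold J
    linarith
  · have h1 : ∑ k ∈ Finset.range D.N,
          D.l (D.predict θ x v 0 k, D.K (D.predict θ x v 0 k) + v k) -
        ∑ k ∈ Finset.range D.N,
          D.l (D.predict θ' x' v 0 k, D.K (D.predict θ' x' v 0 k) + v k) ≤
        D.N * (7 * Cl * (k₀ * P * (Y + Y))) * δ := by
      rw [← Finset.sum_sub_distrib]
      have := Finset.sum_le_card_nsmul (Finset.range D.N)
        (fun k => D.l (D.predict θ x v 0 k, D.K (D.predict θ x v 0 k) + v k) -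
          D.l (D.predict θ' x' v 0 k, D.K (D.predict θ' x' v 0 k) + v k))
        (7 * Cl * (k₀ * (P * δ) * (Y + Y)))
        (fun k hk => by
          rw [Finset.mem_range] at hk
          refine (le_abs_self _).trans ((abs_quadraticForm_sub_le hCl.le hl _ _).trans ?_)
          have e1 := hynorm _ k hk (hp k hk.le).1
          have e2 := hynorm _ k hk (hp' k hk.le).1
          have e3 : ‖(D.predict θ x v 0 k, D.K (D.predict θ x v 0 k) + v k) -
              (D.predict θ' x' v 0 k, D.K (D.predict θ' x' v 0 k) + v k)‖ ≤ k₀ * (P * δ) := by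
            rw [Prod.mk_sub_mk, add_sub_add_right_eq_sub, ← map_sub, Prod.norm_mk]
            have := mul_le_mul_of_nonneg_left (hp k hk.le).2 hk₀0.le
            exact max_le ((hK _).1.trans this) ((hK _).2.trans this)
          gcongr)
      rw [Finset.card_range, nsmul_eq_mul] at this
      refine this.trans (le_of_eq ?_)
      ring
    have h2 : V (D.predict θ x v 0 D.N) - V' (D.predict θ' x' v 0 D.N) ≤
        (CV * P ^ 2 + 7 * CV * (P * (P + P))) * δ := by
      obtain ⟨e1, e2⟩ := hp D.N le_rfl
      have e3 := (hp' D.N le_rfl).1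
      set y := D.predict θ x v 0 D.N
      set y' := D.predict θ' x' v 0 D.N
      have e4 : V y - V' y ≤ CV * δ * P ^ 2 := by
        refine (le_abs_self _).trans ((hVl θ hθ θ' hθ' V V' hV hV' y).trans ?_)
        have : ‖θ - θ'‖ ≤ δ := le_add_of_nonneg_right (norm_nonneg _)
        gcongr
      have e5 : V' y - V' y' ≤ 7 * CV * (P * δ * (P + P)) := by
        refine (le_abs_self _).trans ((abs_quadraticForm_sub_le (by linarith)
          (hVb θ' hθ' V' hV') y y').trans ?_)
        gcongr
      linarith
    have h3 : 0 ≤ (D.N * (Cl * Y ^ 2) + CV * P ^ 2) * δ := by positivity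
    unfold J
    linarith

/-! ### Feasible pairs -/

lemma IsFeasiblePair.tube_nonempty {x : E nx} {Θ : Set (E p)} {v : ℕ → E nu}
    {𝒳 : ℕ → Set (E nx)} (h : D.IsFeasiblePair x Θ v 𝒳) (hΘ : Θ.Nonempty) (hW : D.W.Nonempty)
    (k : ℕ) (hk : k ≤ D.N) : (𝒳 k).Nonempty := by
  obtain ⟨θ, hθ⟩ := hΘ
  obtain ⟨w, hw⟩ := hW
  induction k with
  | zero => exact ⟨x, h.initial⟩
  | succ k ih =>
    obtain ⟨y, hy⟩ := ih (by omega)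
    exact ⟨_, h.step k (by omega) θ hθ y hy w hw⟩

/-- The new tube does not depend on `σ`: the appended step starts inside the terminal set, which
tolerates every element of `S`. Hence sequences with different tails can share a tube. -/
lemma IsFeasiblePair.shift (hD : D.Admissible) {x x' : E nx} {Θ Θ' : Set (E p)} {v : ℕ → E nu}
    {𝒳 : ℕ → Set (E nx)} (h : D.IsFeasiblePair x Θ v 𝒳) (hΘ : Θ' ⊆ Θ) (hΘ₀ : Θ' ⊆ D.Θ₀)
    (hx' : x' ∈ 𝒳 1) {σ : E nu} (hσ : σ ∈ D.S) :
    D.IsFeasiblePair x' Θ' (D.shiftAppend v σ) (fun k => if k < D.N then 𝒳 (k + 1) else D.XT) := by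
  have hN := hD.horizon_pos
  have hsub : ∀ k < D.N, ¬ k + 1 < D.N → 𝒳 (k + 1) ⊆ D.XT := by
    intro k hk hk'
    rw [show k + 1 = D.N by omega]
    exact h.terminal
  refine ⟨fun k _ => ?_, fun k hk => ?_, fun k hk y hy => ?_, fun k hk θ hθ y hy w hw => ?_, ?_, ?_⟩
  · split_ifs
    · exact h.tubeSet _ (by omega)
    · exact hD.terminal_tubeSet
  · rw [if_pos hk]
    by_cases hk' : k + 1 < D.N
    · exact h.state _ hk'
    · exact (hsub k hk hk').trans hD.terminal_state
  · rw [if_pos hk] at hy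
    by_cases hk' : k + 1 < D.N
    · rw [shiftAppend, if_pos hk']
      exact h.input _ hk' y hy
    · rw [shiftAppend, if_neg hk']
      exact hD.terminal_input y (hsub k hk hk' hy) σ hσ
  · rw [if_pos hk] at hy
    by_cases hk' : k + 1 < D.N
    · rw [shiftAppend, if_pos hk', if_pos hk']
      exact h.step _ hk' θ (hΘ hθ) y hy w hw
    · rw [shiftAppend, if_neg hk', if_neg hk']
      exact hD.terminal_invariant θ (hΘ₀ hθ) y (hsub k hk hk' hy) σ hσ w hw
  · simpa [hN] using hx'
  · simp

/-- In the terminal set, the terminal control law is feasible. -/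
lemma isFeasiblePair_terminal (hD : D.Admissible) (hS : (0 : E nu) ∈ D.S) {x : E nx}
    (hx : x ∈ D.XT) {Θ : Set (E p)} (hΘ : Θ ⊆ D.Θ₀) :
    D.IsFeasiblePair x Θ 0 fun _ => D.XT where
  tubeSet _ _ := hD.terminal_tubeSet
  state _ _ := hD.terminal_state
  input _ _ y hy := hD.terminal_input y hy 0 hS
  step _ _ θ hθ y hy w hw := hD.terminal_invariant θ (hΘ hθ) y hy 0 hS w hw
  initial := hx
  terminal := subset_rfl

/-- The input constraint bounds only `K y + v k` for `y` in a cross section, so a point of each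
cross section is needed; nonempty parameter and disturbance sets provide one. -/
lemma exists_feasible_bound (hD : D.Admissible) (hW : D.W.Nonempty) : ∃ R, 0 < R ∧
    ∀ x Θ v 𝒳, D.IsFeasiblePair x Θ v 𝒳 → Θ.Nonempty → ‖x‖ ≤ R ∧ ∀ k < D.N, ‖v k‖ ≤ R := by
  obtain ⟨RX, hRX0, hRX⟩ := hD.polytope_X.isBounded.exists_pos_norm_le
  obtain ⟨RU, hRU0, hRU⟩ := hD.polytope_U.isBounded.exists_pos_norm_le
  have hKR : 0 ≤ ‖D.K‖ * RX := by positivity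
  refine ⟨RX + RU + ‖D.K‖ * RX, by positivity, fun x Θ v 𝒳 h hΘ => ⟨?_, fun k hk => ?_⟩⟩
  · have := hRX x (h.state 0 hD.horizon_pos h.initial)
    linarith
  · obtain ⟨y, hy⟩ := h.tube_nonempty hΘ hW k hk.le
    have h1 := hRU _ (h.input k hk y hy)
    have h2 : ‖D.K y‖ ≤ ‖D.K‖ * RX :=
      (D.K.le_opNorm y).trans (by gcongr; exact hRX y (h.state k hk hy))
    have h3 := norm_sub_le (D.K y + v k) (D.K y)
    rw [add_sub_cancel_left] at h3
    linarith

/-- The optimal cost is bounded by a multiple of the squared norm of the state. -/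
lemma exists_solution_J_le (hD : D.Admissible) (hW : D.W.Nonempty) (hS : (0 : E nu) ∈ D.S)
    {r : ℝ} (hr : 0 < r) (hball : Metric.ball (0 : E nx) r ⊆ D.XT) : ∃ C, 0 < C ∧
      ∀ V x Θ θ v 𝒳, D.IsSolution V x Θ θ v 𝒳 → Θ ⊆ D.Θ₀ → θ ∈ Θ → D.IsTerminalCost θ V →
        D.J V x θ v ≤ C * ‖x‖ ^ 2 := by
  obtain ⟨R, hR, hfeas⟩ := exists_feasible_bound hD hW
  obtain ⟨CJ, hCJ, hJ⟩ := exists_J_bound hD hR.le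
  obtain ⟨CV, hCV, hVb, -⟩ := exists_terminalCost_bound hD
  refine ⟨CV + CJ / r ^ 2, by positivity, fun V x Θ θ v 𝒳 hsol hΘ hθ hV => ?_⟩
  -- Near the origin the zero sequence is feasible and costs `V x`; away from it, the uniform bound
  -- on the cost is absorbed by `‖x‖ ^ 2 ≥ r ^ 2`.
  rcases lt_or_ge ‖x‖ r with hx | hx
  · have h1 := hsol.2 0 _ (isFeasiblePair_terminal hD hS (hball (mem_ball_zero_iff.mpr hx)) hΘ)
    rw [J_zero hV x 0 fun _ _ => rfl] at h1
    have h2 := (le_abs_self _).trans (hVb θ (hΘ hθ) V hV x)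
    have h3 : 0 ≤ CJ / r ^ 2 * ‖x‖ ^ 2 := by positivity
    linarith
  · obtain ⟨hxR, hvR⟩ := hfeas x Θ v 𝒳 hsol.1 ⟨θ, hθ⟩
    have h1 := (hJ θ (hΘ hθ) θ (hΘ hθ) V V hV hV x x hxR hxR v hvR).1
    have h2 : CJ = CJ / r ^ 2 * r ^ 2 := by field_simp
    have h3 : CJ / r ^ 2 * r ^ 2 ≤ CJ / r ^ 2 * ‖x‖ ^ 2 := by gcongr
    have h4 : 0 ≤ CV * ‖x‖ ^ 2 := by positivity
    linarith

end Design

/-! ### Comparison functions -/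

lemma isClassK_sqrt_add {b : ℝ} (hb : 0 ≤ b) : IsClassK fun r => b * √r + r where
  continuousOn := by fun_prop
  strictMonoOn r _ r' _ h :=
    add_lt_add_of_le_of_lt (mul_le_mul_of_nonneg_left (Real.sqrt_le_sqrt h.le) hb) h
  map_zero := by simp

lemma isClassKL_mul {g : ℕ → ℝ} (hpos : ∀ t, 0 < g t) (hanti : Antitone g)
    (hlim : Filter.Tendsto g Filter.atTop (nhds 0)) : IsClassKL fun r t => g t * r where
  classK t :=
    { continuousOn := by fun_prop
      strictMonoOn := fun r _ r' _ h => mul_lt_mul_of_pos_left h (hpos t)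
      map_zero := by simp }
  antitone r hr _ _ h := mul_le_mul_of_nonneg_right (hanti h) hr
  tendsto r _ := by simpa using hlim.mul_const r

lemma norm_le_runningMax {V : Type*} [NormedAddCommGroup V] (d : ℕ → V) {t T : ℕ} (h : t < T) :
    ‖d t‖ ≤ runningMax d T := by
  have := Finset.le_sup (f := fun τ => ‖d τ‖₊) (Finset.mem_range.mpr h)
  exact_mod_cast this

lemma runningMax_le {V : Type*} [NormedAddCommGroup V] {d : ℕ → V} {T : ℕ} {b : ℝ} (hb : 0 ≤ b)
    (h : ∀ t < T, ‖d t‖ ≤ b) : runningMax d T ≤ b := by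
  lift b to ℝ≥0 using hb
  exact NNReal.coe_le_coe.mpr (Finset.sup_le fun t ht => h t (Finset.mem_range.mp ht))

/-- The sum is at most twice the larger argument. -/
lemma IsClassK.apply_add_le {g : ℝ → ℝ} (hg : IsClassK g) {a b : ℝ} (ha : 0 ≤ a) (hb : 0 ≤ b) :
    g (a + b) ≤ g (2 * a) + g (2 * b) := by
  have hmono := hg.strictMonoOn.monotoneOn
  have hnonneg : ∀ r, 0 ≤ r → 0 ≤ g r := fun r hr => by
    rw [← hg.map_zero]
    exact hmono Set.self_mem_Ici hr hr
  have h2a : 0 ≤ 2 * a := by positivity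
  have h2b : 0 ≤ 2 * b := by positivity
  rcases le_total a b with h | h
  · exact (hmono (add_nonneg ha hb) h2b (by linarith)).trans
      (le_add_of_nonneg_left (hnonneg _ h2a))
  · exact (hmono (add_nonneg ha hb) h2a (by linarith)).trans
      (le_add_of_nonneg_right (hnonneg _ h2b))

lemma IsClassK.comp_two_mul {g : ℝ → ℝ} (hg : IsClassK g) : IsClassK fun r => g (2 * r) where
  continuousOn := hg.continuousOn.comp (by fun_prop) fun r (hr : 0 ≤ r) =>
    Set.mem_Ici.mpr (by positivity)
  strictMonoOn r (hr : 0 ≤ r) r' (hr' : 0 ≤ r') h :=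
    hg.strictMonoOn (Set.mem_Ici.mpr (by positivity)) (Set.mem_Ici.mpr (by positivity))
      (by linarith)
  map_zero := by rw [mul_zero, hg.map_zero]

lemma runningMax_nonneg {V : Type*} [NormedAddCommGroup V] (d : ℕ → V) (T : ℕ) :
    0 ≤ runningMax d T := NNReal.coe_nonneg _

namespace Design

variable {nx nu nw p nT : ℕ} {D : Design nx nu nw p nT}

namespace Run

/-! ### Adopted input sequences without the random tail -/

open Classical in
/-- The input sequences that result from the algorithm if the appended random inputs are replaced
by zero, for an excitation check that fails at the times in `c`. -/
def deterministicPart (r : Run D) (c : ℕ → Prop) : ℕ → ℕ → E nu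
  | 0 => r.vopt 0
  | t + 1 => if c (t + 1) then D.shiftAppend (deterministicPart r c t) 0 else r.vopt (t + 1)

lemma deterministicPart_of_not (r : Run D) {c : ℕ → Prop} {t : ℕ} (h : ¬ c t) :
    r.deterministicPart c t = r.vopt t := by
  cases t with
  | zero => rfl
  | succ t => exact if_neg h

lemma deterministicPart_succ_of (r : Run D) {c : ℕ → Prop} {t : ℕ} (h : c (t + 1)) :
    r.deterministicPart c (t + 1) = D.shiftAppend (r.deterministicPart c t) 0 := if_pos h

/-- Each failure appends one zero, so `j + 1` consecutive failures annihilate the last `j + 1`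
entries; with `j = N - 1` the whole sequence vanishes. -/
lemma deterministicPart_eq_zero (r : Run D) {c : ℕ → Prop} (hc : ¬ c 0) (t j : ℕ)
    (h : ∀ i ≤ j, c (t + i)) (k : ℕ) (hk : D.N ≤ k + j + 1) :
    r.deterministicPart c (t + j) k = 0 := by
  induction j generalizing k with
  | zero =>
    have ht := h 0 le_rfl
    cases t with
    | zero => exact absurd ht hc
    | succ t => rw [add_zero, r.deterministicPart_succ_of ht, shiftAppend, if_neg (by omega)]
  | succ j ih =>
    have hj : c (t + j + 1) := h (j + 1) le_rfl
    rw [← add_assoc, r.deterministicPart_succ_of hj, shiftAppend]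
    split_ifs
    · exact ih (fun i hi => h i (by omega)) (k + 1) (by omega)
    · rfl

variable {Ω : Type*} [MeasurableSpace Ω] {P : Measure Ω} {w : ℕ → Ω → E nw} {s : ℕ → Ω → E nu}
  {θs : E p} {ω : Ω} {r : Run D} {T : ℕ}

lemma not_checkFails_zero (r : Run D) (σ : ℕ → E nu) : ¬ r.CheckFails P w s σ 0 :=
  fun h => lt_irrefl 0 h.1

/-- The parameter sets are nested and contain the true parameter. -/
lemma IsExecution.parameter (hr : r.IsExecution P w s θs ω T) (hw : ∀ t, w t ω ∈ D.W)
    (hθ : θs ∈ D.Θ₀) (t : ℕ) (ht : t ≤ T) : θs ∈ r.Θ t ∧ r.Θ t ⊆ D.Θ₀ := by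
  induction t with
  | zero => simpa [Θ, Θ₀, hr.μ_zero] using hθ
  | succ t ih =>
    obtain ⟨h1, h2⟩ := ih (by omega)
    have hlub := hr.μ_succ t (by omega)
    refine ⟨fun i => (hlub i).1 ⟨θs, ⟨h1, fun τ hτ hτt _ => ?_⟩, rfl⟩, fun θ hθ => h2 fun i =>
      (hθ i).trans ((hlub i).2 ?_)⟩
    · obtain ⟨τ, rfl⟩ : ∃ τ', τ = τ' + 1 := ⟨τ - 1, by omega⟩
      refine ⟨w τ ω, hw τ, ?_⟩
      rw [hr.plant τ (by omega), Nat.add_sub_cancel]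
      abel
    · rintro _ ⟨θ', hθ', rfl⟩
      exact hθ'.1 i

lemma IsExecution.Θ_succ_subset (hr : r.IsExecution P w s θs ω T) {t : ℕ} (ht : t < T) :
    r.Θ (t + 1) ⊆ r.Θ t := fun θ hθ i => (hθ i).trans <| (hr.μ_succ t ht i).2 <| by
  rintro _ ⟨θ', hθ', rfl⟩
  exact hθ'.1 i

lemma IsExecution.state_succ (hr : r.IsExecution P w s θs ω T) {t : ℕ} (ht : t < T) :
    r.x (t + 1) = D.AK θs (r.x t) + D.Bθ θs (r.v t 0) + D.F (w t ω) := by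
  rw [hr.plant t ht, hr.control t ht]
  simp only [AK, map_add, add_apply, ContinuousLinearMap.comp_apply, add_assoc]

open Classical in
/-- An adopted input sequence consists of its deterministic part, and of those random inputs
that have been appended since the excitation check has last been passed. -/
lemma IsExecution.adopted_eq (hr : r.IsExecution P w s θs ω T) (t : ℕ) (ht : t < T) (k : ℕ)
    (hk : k < D.N) :
    r.v t k = r.deterministicPart (r.CheckFails P w s fun j => s j ω) t k +
      if ∀ τ ≤ t, t + k < τ + D.N → r.CheckFails P w s (fun j => s j ω) τ then s (t + k) ω
      else 0 := by
  set c := r.CheckFails P w s fun j => s j ω with hc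
  induction t generalizing k with
  | zero =>
    have h0 : ¬ c 0 := r.not_checkFails_zero _
    rw [hr.adopted 0 ht, ← hc, if_neg h0, if_neg fun h => h0 (h 0 le_rfl (by omega)), add_zero]
    rfl
  | succ t ih =>
    rw [hr.adopted (t + 1) ht, ← hc]
    by_cases h : c (t + 1)
    · rw [if_pos h, r.deterministicPart_succ_of h, vref, shiftAppend, Nat.add_sub_cancel]
      by_cases hk' : k + 1 < D.N
      · rw [if_pos hk', if_pos hk', ih (by omega) (k + 1) hk']
        have e : t + (k + 1) = t + 1 + k := by omega
        rw [e]
        congr 1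
        -- The shift adds only the time `τ = t + 1` to the condition, and the check fails there by
        -- assumption.
        refine if_congr ⟨fun H τ hτ hlt => ?_, fun H τ hτ hlt => H τ (by omega) hlt⟩ rfl rfl
        rcases Nat.lt_or_ge t τ with h1 | h1
        · rwa [show τ = t + 1 by omega]
        · exact H τ h1 hlt
      -- At the appended position the condition involves only `τ = t + 1`, so the random input is
      -- present.
      · have e : D.N - 1 = k := by omega
        rw [if_neg hk', if_neg hk', e, zero_add, if_pos]
        intro τ hτ hlt
        rwa [show τ = t + 1 by omega]
    · rw [if_neg h, r.deterministicPart_of_not h,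
        if_neg fun H => h (H (t + 1) le_rfl (by omega)), add_zero]

lemma IsExecution.first_input (hr : r.IsExecution P w s θs ω T) (hN : 0 < D.N) {t : ℕ}
    (ht : t < T) :
    r.v t 0 = r.deterministicPart (r.CheckFails P w s fun j => s j ω) t 0 +
      r.injected P w s ω t := hr.adopted_eq t ht 0 hN

/-- The adopted sequence and its deterministic part are feasible with a common tube. -/
lemma IsExecution.feasiblePair (hr : r.IsExecution P w s θs ω T) (hD : D.Admissible)
    (hθ : θs ∈ D.Θ₀) (hw : ∀ t, w t ω ∈ D.W) (hs : ∀ t, s t ω ∈ D.S) (hS : (0 : E nu) ∈ D.S)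
    (t : ℕ) (ht : t < T) : ∃ 𝒳, D.IsFeasiblePair (r.x t) (r.Θ t) (r.v t) 𝒳 ∧
      D.IsFeasiblePair (r.x t) (r.Θ t)
        (r.deterministicPart (r.CheckFails P w s fun j => s j ω) t) 𝒳 := by
  set c := r.CheckFails P w s fun j => s j ω with hc
  have hpass : ∀ t < T, ¬ c t → ∃ 𝒳, D.IsFeasiblePair (r.x t) (r.Θ t) (r.v t) 𝒳 ∧
      D.IsFeasiblePair (r.x t) (r.Θ t) (r.deterministicPart c t) 𝒳 := by
    intro t ht h
    rw [hr.adopted t ht, ← hc, if_neg h, r.deterministicPart_of_not h]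
    exact ⟨_, (hr.solution t ht).1, (hr.solution t ht).1⟩
  induction t with
  | zero => exact hpass 0 ht (r.not_checkFails_zero _)
  | succ t ih =>
    by_cases h : c (t + 1)
    · obtain ⟨𝒳, h1, h2⟩ := ih (by omega)
      have hsub := hr.Θ_succ_subset (t := t) (by omega)
      have hsub₀ := (hr.parameter hw hθ (t + 1) ht.le).2
      have hx : r.x (t + 1) ∈ 𝒳 1 := by
        rw [hr.state_succ (by omega)]
        exact h1.step 0 hD.horizon_pos θs (hr.parameter hw hθ t (by omega)).1 _ h1.initial _ (hw t)
      rw [hr.adopted (t + 1) ht, ← hc, if_pos h, r.deterministicPart_succ_of h]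
      exact ⟨_, h1.shift hD hsub hsub₀ hx (hs _), h2.shift hD hsub hsub₀ hx hS⟩
    · exact hpass (t + 1) ht h

lemma IsExecution.feasible (hr : r.IsExecution P w s θs ω T) (hD : D.Admissible)
    (hθ : θs ∈ D.Θ₀) (hw : ∀ t, w t ω ∈ D.W) (hs : ∀ t, s t ω ∈ D.S) (hS : (0 : E nu) ∈ D.S)
    (h0 : D.Feasible (r.x 0) D.Θ₀) : D.Feasible (r.x T) (r.Θ T) := by
  cases T with
  | zero =>
    have : r.Θ 0 = D.Θ₀ := by rw [Θ, Θ₀, hr.μ_zero]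
    rwa [this]
  | succ T =>
    obtain ⟨𝒳, h1, -⟩ := hr.feasiblePair hD hθ hw hs hS T T.lt_succ_self
    have hx : r.x (T + 1) ∈ 𝒳 1 := by
      rw [hr.state_succ T.lt_succ_self]
      exact h1.step 0 hD.horizon_pos θs (hr.parameter hw hθ T (by omega)).1 _ h1.initial _ (hw T)
    exact ⟨_, _, h1.shift hD (hr.Θ_succ_subset T.lt_succ_self)
      (hr.parameter hw hθ (T + 1) le_rfl).2 hx hS⟩

lemma IsExecution.isSolution_deterministicPart (hr : r.IsExecution P w s θs ω T) {t : ℕ}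
    (ht : t < T) (h : ¬ r.CheckFails P w s (fun j => s j ω) t) :
    D.IsSolution (r.V t) (r.x t) (r.Θ t) (r.θhat t)
      (r.deterministicPart (r.CheckFails P w s fun j => s j ω) t) (r.tube t) := by
  rw [r.deterministicPart_of_not h]
  exact hr.solution t ht

/-- The cost of the deterministic part does not exceed that of the shifted sequence. -/
lemma IsExecution.J_le_shift (hr : r.IsExecution P w s θs ω T) (hD : D.Admissible)
    (hθ : θs ∈ D.Θ₀) (hw : ∀ t, w t ω ∈ D.W) (hs : ∀ t, s t ω ∈ D.S) (hS : (0 : E nu) ∈ D.S)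
    {t : ℕ} (ht : t + 1 < T) :
    D.J (r.V (t + 1)) (r.x (t + 1)) (r.θhat (t + 1))
        (r.deterministicPart (r.CheckFails P w s fun j => s j ω) (t + 1)) ≤
      D.J (r.V (t + 1)) (r.x (t + 1)) (r.θhat (t + 1))
        (D.shiftAppend (r.deterministicPart (r.CheckFails P w s fun j => s j ω) t) 0) := by
  -- After a failure both sequences coincide by construction; after a pass the optimal one competes
  -- with the shift, which is feasible.
  by_cases h : r.CheckFails P w s (fun j => s j ω) (t + 1)
  · rw [r.deterministicPart_succ_of h]
  · obtain ⟨𝒳, h1, h2⟩ := hr.feasiblePair hD hθ hw hs hS t (by omega)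
    have hx : r.x (t + 1) ∈ 𝒳 1 := by
      rw [hr.state_succ (by omega)]
      exact h1.step 0 hD.horizon_pos θs (hr.parameter hw hθ t (by omega)).1 _ h1.initial _ (hw t)
    exact (hr.isSolution_deterministicPart ht h).2 _ _ (h2.shift hD
      (hr.Θ_succ_subset (by omega)) (hr.parameter hw hθ (t + 1) ht.le).2 hx hS)

/-- The error of the nominal one-step prediction along the deterministic part splits into the acting
input and the model mismatch, which is what the decrease estimate has to absorb. -/
lemma IsExecution.state_succ_sub (hr : r.IsExecution P w s θs ω T) (hN : 0 < D.N) {t : ℕ}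
    (ht : t < T) :
    r.x (t + 1) - (D.AK (r.θhat t) (r.x t) +
        D.Bθ (r.θhat t) (r.deterministicPart (r.CheckFails P w s fun j => s j ω) t 0)) =
      (D.F (w t ω) + D.Bθ θs (r.injected P w s ω t)) + (D.AK θs - D.AK (r.θhat t)) (r.x t) +
        (D.Bθ θs - D.Bθ (r.θhat t))
          (r.deterministicPart (r.CheckFails P w s fun j => s j ω) t 0) := by
  rw [hr.state_succ ht, hr.first_input hN ht]
  simp only [map_add, sub_apply]
  abel

end Run

/-! ### Lyapunov decrease and gain estimates -/

/-- Decrease of the cost of the deterministic part along the closed loop. -/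
lemma exists_J_decrease (hD : D.Admissible) (hW : D.W.Nonempty) (hS : (0 : E nu) ∈ D.S)
    {θs : E p} (hθ : θs ∈ D.Θ₀) : ∃ C, 0 < C ∧
    ∀ {Ω : Type*} [MeasurableSpace Ω] (P : Measure Ω) (w : ℕ → Ω → E nw) (s : ℕ → Ω → E nu)
      (ω : Ω) (r : Run D) (T : ℕ), r.IsExecution P w s θs ω T → (∀ t, w t ω ∈ D.W) →
      (∀ t, s t ω ∈ D.S) → ∀ d e : ℝ,
      (∀ t < T, ‖D.F (w t ω) + D.Bθ θs (r.injected P w s ω t)‖ ≤ d) →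
      (∀ t < T, ‖r.θhat t - θs‖ ≤ e) → ∀ t, t + 1 < T →
      D.J (r.V (t + 1)) (r.x (t + 1)) (r.θhat (t + 1))
        (r.deterministicPart (r.CheckFails P w s fun j => s j ω) (t + 1)) ≤
      D.J (r.V t) (r.x t) (r.θhat t)
        (r.deterministicPart (r.CheckFails P w s fun j => s j ω) t) -
      D.l (r.x t,
        D.K (r.x t) + r.deterministicPart (r.CheckFails P w s fun j => s j ω) t 0) +
      C * (d + e) := by
  obtain ⟨R, hR, hfeas⟩ := exists_feasible_bound hD hW
  obtain ⟨M, hM, hMb, hMl, -⟩ := exists_model_bound hD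
  have hMR : 0 < M * R := by positivity
  -- The nominal successor need not satisfy the constraints, so the Lipschitz bound is taken on this
  -- larger ball.
  have hR' : R ≤ R + 2 * (M * R) := by linarith
  obtain ⟨C, hC, hJ⟩ := exists_J_bound hD (hR.le.trans hR')
  refine ⟨C * (2 + 2 * (M * R)), by positivity,
    fun P w s ω r T hr hw hs d e hd he t ht => ?_⟩
  have hjs := hr.J_le_shift hD hθ hw hs hS ht
  have hsub := hr.state_succ_sub hD.horizon_pos (t := t) (by omega)
  obtain ⟨𝒳, -, h2⟩ := hr.feasiblePair hD hθ hw hs hS t (by omega)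
  obtain ⟨𝒳', h1', -⟩ := hr.feasiblePair hD hθ hw hs hS (t + 1) ht
  set v := r.deterministicPart (r.CheckFails P w s fun j => s j ω) t with hv
  have hpar := hr.parameter hw hθ t (by omega)
  have hpar' := hr.parameter hw hθ (t + 1) ht.le
  obtain ⟨hx, hvR⟩ := hfeas _ _ _ _ h2 ⟨θs, hpar.1⟩
  have hx' := (hfeas _ _ _ _ h1' ⟨θs, hpar'.1⟩).1
  have hnom := hpar.2 (hr.nominal t (by omega))
  have hnom' := hpar'.2 (hr.nominal (t + 1) ht.le)
  have het := he t (by omega)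
  have het' := he (t + 1) ht
  have he0 : 0 ≤ e := (norm_nonneg _).trans het
  have hv0 := hvR 0 hD.horizon_pos
  set y := D.AK (r.θhat t) (r.x t) + D.Bθ (r.θhat t) (v 0) with hy
  have hyR : ‖y‖ ≤ R + 2 * (M * R) := by
    have e1 : ‖D.AK (r.θhat t) (r.x t)‖ ≤ M * R :=
      (ContinuousLinearMap.le_of_opNorm_le _ (hMb _ hnom).1 _).trans (by gcongr)
    have e2 : ‖D.Bθ (r.θhat t) (v 0)‖ ≤ M * R :=
      (ContinuousLinearMap.le_of_opNorm_le _ (hMb _ hnom).2 _).trans (by gcongr)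
    linarith [norm_add_le (D.AK (r.θhat t) (r.x t)) (D.Bθ (r.θhat t) (v 0))]
  have hshiftR : ∀ j < D.N, ‖D.shiftAppend v 0 j‖ ≤ R + 2 * (M * R) := by
    intro j hj
    rw [shiftAppend]
    split_ifs with hj'
    · exact (hvR _ hj').trans hR'
    · rw [norm_zero]
      linarith
  have hdiff : ‖r.x (t + 1) - y‖ ≤ d + 2 * (M * R) * e := by
    rw [hsub]
    refine norm_add₃_le.trans ?_
    have e1 : ‖(D.AK θs - D.AK (r.θhat t)) (r.x t)‖ ≤ M * e * R := by
      refine (ContinuousLinearMap.le_of_opNorm_le _ (hMl _ _).1 _).trans ?_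
      rw [norm_sub_rev θs]
      gcongr
    have e2 : ‖(D.Bθ θs - D.Bθ (r.θhat t)) (v 0)‖ ≤ M * e * R := by
      refine (ContinuousLinearMap.le_of_opNorm_le _ (hMl _ _).2 _).trans ?_
      rw [norm_sub_rev θs]
      gcongr
    linarith [hd t (by omega)]
  have hθdiff : ‖r.θhat (t + 1) - r.θhat t‖ ≤ 2 * e := by
    have := norm_sub_le (r.θhat (t + 1) - θs) (r.θhat t - θs)
    rw [sub_sub_sub_cancel_right] at this
    linarith
  have hlip := (hJ _ hnom' _ hnom _ _ (hr.terminalCost _ ht.le) (hr.terminalCost t (by omega))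
    _ y (hx'.trans hR') hyR _ hshiftR).2
  rw [J_shift hD.horizon_pos (hr.terminalCost t (by omega)) (r.x t) v] at hlip
  have h3 : C * (‖r.θhat (t + 1) - r.θhat t‖ + ‖r.x (t + 1) - y‖) ≤
      C * (2 * e + (d + 2 * (M * R) * e)) := by gcongr
  have hd0 : 0 ≤ d := (norm_nonneg _).trans (hd t (by omega))
  have h4 : C * (2 * e + (d + 2 * (M * R) * e)) ≤ C * (2 + 2 * (M * R)) * (d + e) := by
    rw [mul_assoc C]
    have h5 : 0 ≤ M * R * d := by positivity
    refine mul_le_mul_of_nonneg_left ?_ hC.le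
    linarith
  linarith

lemma le_add_of_sq_le {z a b c : ℝ} (ha : 0 ≤ a) (hb : 0 ≤ b) (hc : 0 ≤ c)
    (h : z ^ 2 ≤ a ^ 2 + b ^ 2 + c ^ 2) : z ≤ a + b + c := by
  refine le_of_not_gt fun hlt => ?_
  have := pow_lt_pow_left₀ hlt (by positivity) two_ne_zero
  nlinarith [mul_nonneg ha hb, mul_nonneg ha hc, mul_nonneg hb hc]

/-- The closed loop is stable with gains from the acting inputs and from the parameter error. -/
lemma exists_gains (hD : D.Admissible) (hW : D.W.Nonempty) (hS : (0 : E nu) ∈ D.S)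
    {θs : E p} (hθ : θs ∈ D.Θ₀) {r₀ : ℝ} (hr₀ : 0 < r₀)
    (hball : Metric.ball (0 : E nx) r₀ ⊆ D.XT) :
    ∃ (η : ℝ → ℕ → ℝ) (ψ : ℝ → ℝ), IsClassKL η ∧ IsClassK ψ ∧
    ∀ {Ω : Type*} [MeasurableSpace Ω] (P : Measure Ω) (w : ℕ → Ω → E nw) (s : ℕ → Ω → E nu)
      (ω : Ω) (r : Run D) (T : ℕ), r.IsExecution P w s θs ω T → (∀ t, w t ω ∈ D.W) →
      (∀ t, s t ω ∈ D.S) →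
      ‖r.x T‖ ≤ η ‖r.x 0‖ T
          + ψ (runningMax (fun t => D.F (w t ω) + D.Bθ θs (r.injected P w s ω t)) T)
          + ψ (runningMax (fun t => r.θhat t - θs) T) := by
  obtain ⟨M, hM, hMb, -, -⟩ := exists_model_bound hD
  obtain ⟨Cp, hCp, hdec⟩ := exists_J_decrease hD hW hS hθ
  obtain ⟨Cs, hCs, hsol⟩ := exists_solution_J_le hD hW hS hr₀ hball
  obtain ⟨CV, hCV, hVb, -⟩ := exists_terminalCost_bound hD
  obtain ⟨c, hc, hlc⟩ := exists_le_quadraticForm hD.posDef_l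
  have hN := hD.horizon_pos
  -- `Cs` covers optimal sequences and `CV` the zero sequence; the summand `c` makes `c / Cu < 1`,
  -- hence `ρ > 0`.
  set Cu := Cs + CV + c with hCu
  have hCu0 : 0 < Cu := by positivity
  set ρ := 1 - c / Cu with hρ
  have hcC : c / Cu < 1 := by
    rw [div_lt_one hCu0]
    linarith
  have hρ0 : 0 < ρ := by linarith
  have hρ1 : ρ < 1 := by
    have : 0 < c / Cu := by positivity
    linarith
  have h1ρ : 0 < 1 - ρ := by linarith
  set ν := √ρ with hν
  have hν0 : 0 < ν := Real.sqrt_pos.mpr hρ0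
  have hν1 : ν < 1 := by rwa [hν, Real.sqrt_lt' one_pos, one_pow]
  have hνρ : ν ^ 2 = ρ := Real.sq_sqrt hρ0.le
  set Q := (D.N / (1 - ρ) + D.N) * Cp / c with hQ
  have hQ0 : 0 ≤ Q := by positivity
  set Mu := M * (2 + ‖D.K‖) with hMu
  have hMu0 : 0 < Mu := by positivity
  -- The cost is controlled only up to the last time at which a sequence was adopted, whence `t -
  -- 1`. The summand `1` settles time zero, where `g` must be at least one.
  set g : ℕ → ℝ := fun t => (1 + Mu * √(Cu / c)) * ν ^ ((t - 1) / D.N) with hg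
  have hgpos : ∀ t, 0 < g t := fun t => by positivity
  have hganti : Antitone g := fun t t' h => by
    have : (t - 1) / D.N ≤ (t' - 1) / D.N := Nat.div_le_div_right (by omega)
    exact mul_le_mul_of_nonneg_left (pow_le_pow_of_le_one hν0.le hν1.le this) (by positivity)
  have hglim : Filter.Tendsto g Filter.atTop (nhds 0) := by
    have h1 : Filter.Tendsto (fun t : ℕ => (t - 1) / D.N) Filter.atTop Filter.atTop :=
      (Nat.tendsto_div_const_atTop hN.ne').comp (Filter.tendsto_sub_atTop_nat 1)
    have h2 := ((tendsto_pow_atTop_nhds_zero_of_lt_one hν0.le hν1).comp h1).const_mul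
      (1 + Mu * √(Cu / c))
    simpa [hg, Function.comp_def] using h2
  refine ⟨fun r t => g t * r, fun r => Mu * √Q * √r + r, isClassKL_mul hgpos hganti hglim,
    isClassK_sqrt_add (by positivity), fun P w s ω r T hr hw hs => ?_⟩
  set d := runningMax (fun t => D.F (w t ω) + D.Bθ θs (r.injected P w s ω t)) T with hd
  set e := runningMax (fun t => r.θhat t - θs) T with he
  have hd0 : 0 ≤ d := runningMax_nonneg _ _
  have he0 : 0 ≤ e := runningMax_nonneg _ _
  have hψd : 0 ≤ Mu * √Q * √d := by positivity
  have hψe : 0 ≤ Mu * √Q * √e := by positivity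
  beta_reduce
  cases T with
  | zero =>
    have h1 : 1 ≤ g 0 := by
      have : 0 ≤ Mu * √(Cu / c) := by positivity
      simp only [hg, Nat.zero_sub, Nat.zero_div, pow_zero, mul_one]
      linarith
    have h2 := mul_le_mul_of_nonneg_right h1 (norm_nonneg (r.x 0))
    linarith
  | succ T =>
    have hdd : ∀ t < T + 1, ‖D.F (w t ω) + D.Bθ θs (r.injected P w s ω t)‖ ≤ d := fun t ht =>
      norm_le_runningMax (fun t => D.F (w t ω) + D.Bθ θs (r.injected P w s ω t)) ht
    have hee : ∀ t < T + 1, ‖r.θhat t - θs‖ ≤ e := fun t ht =>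
      norm_le_runningMax (fun t => r.θhat t - θs) ht
    set cf := r.CheckFails P w s fun j => s j ω with hcf
    set v := r.deterministicPart cf with hv
    set a : ℕ → ℝ := fun t => D.J (r.V t) (r.x t) (r.θhat t) (v t) with ha
    have hup : ∀ t < T + 1, (¬ cf t ∨ ∀ k < D.N, v t k = 0) → a t ≤ Cu * ‖r.x t‖ ^ 2 := by
      intro t ht hcase
      have hpar := hr.parameter hw hθ t ht.le
      have hnom := hr.nominal t ht.le
      have htc := hr.terminalCost t ht.le
      have hx0 := sq_nonneg ‖r.x t‖
      have e1 := mul_nonneg hCs.le hx0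
      have e2 := mul_nonneg (by linarith : 0 ≤ CV) hx0
      have e3 := mul_nonneg hc.le hx0
      rcases hcase with h | h
      · have := hsol _ _ _ _ _ _ (hr.isSolution_deterministicPart ht h) hpar.2 hnom htc
        linarith
      · have h1 : a t = r.V t (r.x t) := J_zero htc (r.x t) (v t) h
        have h2 := (le_abs_self _).trans (hVb _ (hpar.2 hnom) _ htc (r.x t))
        linarith
    have hstep : ∀ t, t + 1 < T + 1 →
        a (t + 1) ≤ a t - D.l (r.x t, D.K (r.x t) + v t 0) + Cp * (d + e) :=
      fun t ht => hdec P w s ω r (T + 1) hr hw hs d e hdd hee t ht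
    have hdrift : ∀ t, t + 1 < T + 1 → a (t + 1) ≤ a t + Cp * (d + e) := fun t ht => by
      have h1 := hstep t ht
      have h2 := hD.posDef_l.nonneg (r.x t, D.K (r.x t) + v t 0)
      linarith
    have hcontract : ∀ t, t + 1 < T + 1 → (¬ cf t ∨ ∀ k < D.N, v t k = 0) →
        a (t + 1) ≤ ρ * a t + Cp * (d + e) := by
      intro t ht hcase
      have h1 := hstep t ht
      have h2 := hup t (by omega) hcase
      have h3 := hlc (r.x t, D.K (r.x t) + v t 0)
      have h4 : ‖r.x t‖ ≤ ‖(r.x t, D.K (r.x t) + v t 0)‖ :=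
        norm_fst_le (r.x t, D.K (r.x t) + v t 0)
      have h5 : c * ‖r.x t‖ ^ 2 ≤ c * ‖(r.x t, D.K (r.x t) + v t 0)‖ ^ 2 := by gcongr
      have h6 : c / Cu * a t ≤ c * ‖r.x t‖ ^ 2 := by
        have := mul_le_mul_of_nonneg_left h2 (by positivity : 0 ≤ c / Cu)
        have e1 : c / Cu * (Cu * ‖r.x t‖ ^ 2) = c * ‖r.x t‖ ^ 2 := by field_simp
        linarith
      have h7 : ρ * a t = a t - c / Cu * a t := by rw [hρ]; ring
      linarith
    -- Either some check in the window passes, or all `N` fail and the stripped sequence is zero at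
    -- the end of the window; both give the quadratic upper bound on the cost.
    have hwin : ∀ t, ∃ j < D.N, t + j + 1 < T + 1 →
        a (t + j + 1) ≤ ρ * a (t + j) + Cp * (d + e) := by
      intro t
      by_cases h : ∃ j < D.N, ¬ cf (t + j)
      · obtain ⟨j, hj, hcj⟩ := h
        exact ⟨j, hj, fun ht => hcontract _ ht (Or.inl hcj)⟩
      · push Not at h
        exact ⟨D.N - 1, by omega, fun ht => hcontract _ ht (Or.inr fun k _ =>
          r.deterministicPart_eq_zero (r.not_checkFails_zero _) t (D.N - 1)
            (fun i hi => h i (by omega)) k (by omega))⟩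
    have hdecay := le_of_window_contraction hN (by positivity : 0 ≤ Cp * (d + e)) hρ0.le hρ1
      hdrift hwin T T.lt_succ_self
    have ha0 := hup 0 T.succ_pos (Or.inl (r.not_checkFails_zero _))
    set z := (r.x T, D.K (r.x T) + v T 0) with hz
    have hzJ : c * ‖z‖ ^ 2 ≤ a T :=
      (hlc z).trans (l_le_J hD (hr.terminalCost T T.le_succ) (r.x T) (v T))
    have hznorm : ‖z‖ ≤ ν ^ (T / D.N) * √(Cu / c) * ‖r.x 0‖ + √Q * √d + √Q * √e := by
      have h1 : c * ‖z‖ ^ 2 ≤ ρ ^ (T / D.N) * (Cu * ‖r.x 0‖ ^ 2) +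
          (D.N / (1 - ρ) + D.N) * (Cp * (d + e)) := by
        refine hzJ.trans (hdecay.trans ?_)
        gcongr
      have h2 : ‖z‖ ^ 2 ≤ ρ ^ (T / D.N) * (Cu / c) * ‖r.x 0‖ ^ 2 + Q * d + Q * e := by
        have h3 : c * (ρ ^ (T / D.N) * (Cu / c) * ‖r.x 0‖ ^ 2 + Q * d + Q * e) =
            ρ ^ (T / D.N) * (Cu * ‖r.x 0‖ ^ 2) +
              (D.N / (1 - ρ) + D.N) * (Cp * (d + e)) := by
          rw [hQ]
          field_simp
          ring
        rw [← h3] at h1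
        exact le_of_mul_le_mul_left h1 hc
      set u₁ := ν ^ (T / D.N) * √(Cu / c) * ‖r.x 0‖ with hu₁
      set u₂ := √Q * √d with hu₂
      set u₃ := √Q * √e with hu₃
      have p1 : 0 ≤ u₁ := by positivity
      have p2 : 0 ≤ u₂ := by positivity
      have p3 : 0 ≤ u₃ := by positivity
      have s1 : u₁ ^ 2 = ρ ^ (T / D.N) * (Cu / c) * ‖r.x 0‖ ^ 2 := by
        rw [hu₁, mul_pow, mul_pow, Real.sq_sqrt (by positivity), ← pow_mul, mul_comm _ 2, pow_mul,
          hνρ]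
      have s2 : u₂ ^ 2 = Q * d := by
        rw [hu₂, mul_pow, Real.sq_sqrt hQ0, Real.sq_sqrt hd0]
      have s3 : u₃ ^ 2 = Q * e := by
        rw [hu₃, mul_pow, Real.sq_sqrt hQ0, Real.sq_sqrt he0]
      rw [← s1, ← s2, ← s3] at h2
      exact le_add_of_sq_le p1 p2 p3 h2
    -- The final state comes from one plant step; positive definiteness of the stage cost in state
    -- and input bounds both parts of `z`.
    have hlast : ‖r.x (T + 1)‖ ≤ Mu * ‖z‖ + d := by
      have e1 : r.x (T + 1) = D.AK θs (r.x T) + D.Bθ θs (v T 0) +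
          (D.F (w T ω) + D.Bθ θs (r.injected P w s ω T)) := by
        rw [hr.state_succ T.lt_succ_self, hr.first_input hN T.lt_succ_self, map_add]
        abel
      have n1 : ‖r.x T‖ ≤ ‖z‖ := norm_fst_le z
      have n2 : ‖D.K (r.x T) + v T 0‖ ≤ ‖z‖ := norm_snd_le z
      have n3 : ‖D.K (r.x T)‖ ≤ ‖D.K‖ * ‖z‖ := (D.K.le_opNorm _).trans (by gcongr)
      have n4 : ‖v T 0‖ ≤ ‖z‖ + ‖D.K‖ * ‖z‖ := by
        have := norm_sub_le (D.K (r.x T) + v T 0) (D.K (r.x T))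
        rw [add_sub_cancel_left] at this
        linarith
      have n5 : ‖D.AK θs (r.x T)‖ ≤ M * ‖z‖ :=
        (ContinuousLinearMap.le_of_opNorm_le _ (hMb _ hθ).1 _).trans (by gcongr)
      have n6 : ‖D.Bθ θs (v T 0)‖ ≤ M * (‖z‖ + ‖D.K‖ * ‖z‖) :=
        (ContinuousLinearMap.le_of_opNorm_le _ (hMb _ hθ).2 _).trans (by gcongr)
      rw [e1]
      refine norm_add₃_le.trans ?_
      have := hdd T T.lt_succ_self
      have e2 : Mu * ‖z‖ = M * ‖z‖ + M * (‖z‖ + ‖D.K‖ * ‖z‖) := by rw [hMu]; ring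
      linarith
    have hfin := mul_le_mul_of_nonneg_left hznorm hMu0.le
    have hgT : g (T + 1) * ‖r.x 0‖ = ν ^ (T / D.N) * ‖r.x 0‖ +
        Mu * (ν ^ (T / D.N) * √(Cu / c) * ‖r.x 0‖) := by
      simp only [hg, Nat.add_sub_cancel]
      ring
    have hpos : 0 ≤ ν ^ (T / D.N) * ‖r.x 0‖ := by positivity
    rw [hgT]
    linarith

end Design

end AdaptiveMPC

end

/-! ### Feasibility, practical stability and gains -/

theorem proposition1 {nx nu nw p nT : ℕ} (D : AdaptiveMPC.Design nx nu nw p nT)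
    (hD : D.Admissible) (θs : AdaptiveMPC.E p) (hθ : D.ParamAssumption θs)
    {Ω : Type*} [MeasurableSpace Ω] (P : Measure Ω) [IsProbabilityMeasure P]
    (w : ℕ → Ω → AdaptiveMPC.E nw) (hw : AdaptiveMPC.IsNoise P D.W w)
    (s : ℕ → Ω → AdaptiveMPC.E nu) (hs : AdaptiveMPC.IsNoise P D.S s) :
    -- recursive feasibility
    (∀ (ω : Ω) (r : AdaptiveMPC.Design.Run D) (T : ℕ), r.IsExecution P w s θs ω T →
      D.Feasible (r.x 0) D.Θ₀ → D.Feasible (r.x T) (r.Θ T)) ∧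
    -- input-to-state practical stability
    AdaptiveMPC.InputToStatePracticallyStable
      (fun T x d => ∃ (ω : Ω) (r : AdaptiveMPC.Design.Run D), r.IsExecution P w s θs ω T ∧
        x = r.x ∧ d = fun t => D.F (w t ω) + D.Bθ θs (if D.N ≤ t then s t ω else 0))
      {x₀ | D.Feasible x₀ D.Θ₀} ∧
    -- gains from the acting disturbance and excitation and from the parameter error
    (∃ (η : ℝ → ℕ → ℝ) (ψ ξ : ℝ → ℝ),
      AdaptiveMPC.IsClassKL η ∧ AdaptiveMPC.IsClassK ψ ∧ AdaptiveMPC.IsClassK ξ ∧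
      ∀ (ω : Ω) (r : AdaptiveMPC.Design.Run D) (T : ℕ), r.IsExecution P w s θs ω T →
        D.Feasible (r.x 0) D.Θ₀ →
        ‖r.x T‖ ≤ η ‖r.x 0‖ T
          + ψ (AdaptiveMPC.runningMax
              (fun t => D.F (w t ω) + D.Bθ θs (r.injected P w s ω t)) T)
          + ξ (AdaptiveMPC.runningMax (fun t => r.θhat t - θs) T)) := by
  have hW := hw.zero_mem hD.compact_W hD.convex_W
  have hS := hs.zero_mem hD.compact_S hD.convex_S
  have hfeas : ∀ (ω : Ω) (r : AdaptiveMPC.Design.Run D) (T : ℕ), r.IsExecution P w s θs ω T →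
      D.Feasible (r.x 0) D.Θ₀ → D.Feasible (r.x T) (r.Θ T) := fun ω r T hr h0 =>
    hr.feasible hD hθ.mem (fun t => hw.mem t ω) (fun t => hs.mem t ω) hS h0
  obtain ⟨η, ψ, hη, hψ, hgain⟩ : ∃ (η : ℝ → ℕ → ℝ) (ψ : ℝ → ℝ),
      AdaptiveMPC.IsClassKL η ∧ AdaptiveMPC.IsClassK ψ ∧
      ∀ (ω : Ω) (r : AdaptiveMPC.Design.Run D) (T : ℕ), r.IsExecution P w s θs ω T →
        D.Feasible (r.x 0) D.Θ₀ →
        ‖r.x T‖ ≤ η ‖r.x 0‖ T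
          + ψ (AdaptiveMPC.runningMax
              (fun t => D.F (w t ω) + D.Bθ θs (r.injected P w s ω t)) T)
          + ψ (AdaptiveMPC.runningMax (fun t => r.θhat t - θs) T) := by
    rcases D.XT.eq_empty_or_nonempty with hXT | hXT
    -- without terminal states the optimisation problem is infeasible
    · refine ⟨fun r t => (1 / 2) ^ t * r, fun r => 0 * √r + r,
        AdaptiveMPC.isClassKL_mul (fun t => by positivity)
          (pow_right_anti₀ (by norm_num) (by norm_num))
          (tendsto_pow_atTop_nhds_zero_of_lt_one (by norm_num) (by norm_num)),
        AdaptiveMPC.isClassK_sqrt_add le_rfl, ?_⟩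
      rintro ω r T hr ⟨v, 𝒳, h⟩
      obtain ⟨y, hy⟩ := h.tube_nonempty ⟨θs, hθ.mem⟩ ⟨0, hW⟩ D.N le_rfl
      exact absurd (h.terminal hy) (by simp [hXT])
    · obtain ⟨ρ, hρ, hSball⟩ := hs.exists_ball_subset hD.compact_S hD.convex_S
      obtain ⟨r₀, hr₀, hball⟩ := AdaptiveMPC.Design.exists_ball_subset_terminal hD hθ.mem
        (hθ.reachable θs hθ.mem) hW hρ hSball hXT
      obtain ⟨η, ψ, hη, hψ, h⟩ :=
        AdaptiveMPC.Design.exists_gains hD ⟨0, hW⟩ hS hθ.mem hr₀ hball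
      exact ⟨η, ψ, hη, hψ, fun ω r T hr _ =>
        h P w s ω r T hr (fun t => hw.mem t ω) fun t => hs.mem t ω⟩
  refine ⟨hfeas, ?_, η, ψ, ψ, hη, hψ, hψ, hgain⟩
  obtain ⟨M, hM, -, -, hdiam⟩ := AdaptiveMPC.Design.exists_model_bound hD
  obtain ⟨R, hR, hSR⟩ := hD.compact_S.isBounded.exists_pos_norm_le
  have hmono := hψ.strictMonoOn.monotoneOn
  have hψ0 : ∀ b, 0 ≤ b → 0 ≤ ψ b := fun b hb => by
    rw [← hψ.map_zero]
    exact hmono Set.self_mem_Ici hb hb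
  -- Acting and nominal excitation are each bounded by `R`, so `b` bounds the effect of their
  -- difference on the state.
  set b := ‖D.Bθ θs‖ * (R + R) with hb
  have hb0 : 0 ≤ b := by positivity
  refine ⟨η, fun r => ψ (2 * r), ψ (2 * b) + ψ M, hη, hψ.comp_two_mul,
    add_nonneg (hψ0 _ (by positivity)) (hψ0 _ (by positivity)), ?_⟩
  rintro T x d ⟨ω, r, hr, rfl, rfl⟩ h0
  have h1 := hgain ω r T hr h0
  set d : ℕ → AdaptiveMPC.E nx :=
    fun t => D.F (w t ω) + D.Bθ θs (if D.N ≤ t then s t ω else 0) with hd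
  have hd0 := AdaptiveMPC.runningMax_nonneg d T
  have h2 : AdaptiveMPC.runningMax
      (fun t => D.F (w t ω) + D.Bθ θs (r.injected P w s ω t)) T ≤
      AdaptiveMPC.runningMax d T + b := by
    refine AdaptiveMPC.runningMax_le (by positivity) fun t ht => ?_
    have e1 : D.F (w t ω) + D.Bθ θs (r.injected P w s ω t) =
        d t + D.Bθ θs (r.injected P w s ω t - if D.N ≤ t then s t ω else 0) := by
      simp only [hd, map_sub]
      abel
    have e2 : ‖r.injected P w s ω t‖ ≤ R := by
      rw [AdaptiveMPC.Design.Run.injected]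
      split_ifs
      · exact hSR _ (hs.mem t ω)
      · simpa using hR.le
    have e3 : ‖if D.N ≤ t then s t ω else 0‖ ≤ R := by
      split_ifs
      · exact hSR _ (hs.mem t ω)
      · simpa using hR.le
    rw [e1]
    refine (norm_add_le _ _).trans (add_le_add (AdaptiveMPC.norm_le_runningMax d ht) ?_)
    refine ((D.Bθ θs).le_opNorm _).trans ?_
    exact mul_le_mul_of_nonneg_left ((norm_sub_le _ _).trans (add_le_add e2 e3)) (norm_nonneg _)
  have h3 : AdaptiveMPC.runningMax (fun t => r.θhat t - θs) T ≤ M := by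
    refine AdaptiveMPC.runningMax_le (by positivity) fun t ht => hdiam _ ?_ _ hθ.mem
    exact (hr.parameter (fun t => hw.mem t ω) hθ.mem t ht.le).2 (hr.nominal t ht.le)
  have h4 := hmono (AdaptiveMPC.runningMax_nonneg _ _) (add_nonneg hd0 hb0) h2
  have h5 := hmono (AdaptiveMPC.runningMax_nonneg _ _) (by positivity : 0 ≤ M) h3
  have h6 := hψ.apply_add_le hd0 hb0
  beta_reduce
  linarith
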